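/- Let $M$ be a connected (Hausdorff, second countable, without boundary) real-analytic surface, not assumed compact or orientable, let $f$ be a real-analytic vector field on $M$, and let $\Phi:\mathbb{R}\times M\to M$ be a continuous flow generated by $f$, that is, for every $p\in M$ the curve $t\mapsto\Phi_p(t)=\Phi(t,p)$ is an integral curve of $f$. Then either $f$ is identically zero, or the set of essential singular points of $\Phi$ is discrete, that is, it consists of isolated points (its subspace topology is discrete). Here a point $p$ is *singular* if $\Phi(t,p)=p$ for all $t\in\mathbb{R}$. A *semi-orbit* of a flow is a set $\Phi_q(I)$ with $I\subset\mathbb{R}$ an interval. Two flows are *locally topologically equivalent* at points $p$ and $p'$ if there is a homeomorphism $h:U\to U'$ between open neighbourhoods of $p$ and $p'$, with $h(p)=p'$, such that $h$ and $h^{-1}$ carry semi-orbits contained in $U$ and $U'$, respectively, onto semi-orbits and preserve time directions. A singular point $p$ of $\Phi$ is *vertical* if $\Phi$ at $p$ is locally topologically equivalent to the flow on $\mathbb{R}^2$ of one of the vector fields $(|x|,0)$, $(x,0)$, $(-x,0)$ at the origin; it is *horizontal* if $\Phi$ at $p$ is locally topologically equivalent to the flow on $\mathbb{R}^2$ of one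 of the vector fields $(|y|,0)$, $(y,0)$ at the origin; and it is *essential* if it is neither vertical nor horizontal. -/

import Mathlib

open scoped Manifold ContDiff Topology

noncomputable section

namespace SurfaceFlow

/-! ### The planar model flows -/

/-- The flow `Ψ` on the plane is the flow of the planar vector field `F`: every integral curve
`t ↦ Ψ t p` solves `x' = F x`. (Only used to validate the explicit model flows below.) -/
def IsPlanarFlowOf (Ψ : Flow ℝ (ℝ × ℝ)) (F : ℝ × ℝ → ℝ × ℝ) : Prop :=
  ∀ (p : ℝ × ℝ) (t : ℝ), HasDerivAt (fun s => Ψ s p) (F (Ψ t p)) t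

/-- The flow of `(|x|, 0)`: `x` is multiplied by `exp t` if `0 ≤ x`, by `exp (-t)` if `x ≤ 0`. -/
def flowV₁ : Flow ℝ (ℝ × ℝ) where
  toFun t p := (Real.exp t * max p.1 0 + Real.exp (-t) * min p.1 0, p.2)
  cont' := by
    simp only [Function.uncurry_def]
    fun_prop
  map_add' s t p := by
    ext
    · have e1 := Real.exp_pos t
      have e2 := Real.exp_pos (-t)
      rcases le_total 0 p.1 with h | h
      · have h' : 0 ≤ Real.exp t * p.1 := by positivity
        simp [h, h', Real.exp_add, mul_assoc]
      · have h' : Real.exp (-t) * p.1 ≤ 0 := mul_nonpos_of_nonneg_of_nonpos e2.le h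
        simp only [max_eq_right h, min_eq_left h, mul_zero, zero_add, max_eq_right h',
          min_eq_left h', neg_add, Real.exp_add, mul_assoc]
    · rfl
  map_zero' p := by
    ext
    · simp
    · rfl

/-- The flow of `(x, 0)`. -/
def flowV₂ : Flow ℝ (ℝ × ℝ) where
  toFun t p := (Real.exp t * p.1, p.2)
  cont' := by
    simp only [Function.uncurry_def]
    fun_prop
  map_add' s t p := by simp [Real.exp_add, mul_assoc]
  map_zero' p := by simp

/-- The flow of `(-x, 0)`. -/
def flowV₃ : Flow ℝ (ℝ × ℝ) where
  toFun t p := (Real.exp (-t) * p.1, p.2)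
  cont' := by
    simp only [Function.uncurry_def]
    fun_prop
  map_add' s t p := by simp only [neg_add, Real.exp_add, mul_assoc]
  map_zero' p := by simp

/-- The flow of `(|y|, 0)`. -/
def flowH₁ : Flow ℝ (ℝ × ℝ) where
  toFun t p := (p.1 + t * |p.2|, p.2)
  cont' := by
    simp only [Function.uncurry_def]
    fun_prop
  map_add' s t p := by
    ext
    · simp only
      ring
    · rfl
  map_zero' p := by simp

/-- The flow of `(y, 0)`. -/
def flowH₂ : Flow ℝ (ℝ × ℝ) where
  toFun t p := (p.1 + t * p.2, p.2)
  cont' := by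
    simp only [Function.uncurry_def]
    fun_prop
  map_add' s t p := by
    ext
    · simp only
      ring
    · rfl
  map_zero' p := by simp

theorem flowV₁_spec : IsPlanarFlowOf flowV₁ (fun p => (|p.1|, 0)) := by
  intro p t
  have e1 := Real.exp_pos t
  have e2 := Real.exp_pos (-t)
  have key : HasDerivAt (fun s : ℝ => Real.exp s * max p.1 0 + Real.exp (-s) * min p.1 0)
      (Real.exp t * max p.1 0 + (Real.exp (-t) * -1) * min p.1 0) t :=
    ((Real.hasDerivAt_exp t).mul_const _).add (((hasDerivAt_neg t).exp).mul_const _)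
  refine HasDerivAt.prodMk ?_ (hasDerivAt_const t p.2)
  refine key.congr_deriv ?_
  change _ = |Real.exp t * max p.1 0 + Real.exp (-t) * min p.1 0|
  rcases le_total 0 p.1 with h | h
  · have h' : 0 ≤ Real.exp t * p.1 := by positivity
    simp only [max_eq_left h, min_eq_right h, mul_zero, add_zero, abs_of_nonneg h']
  · have h' : Real.exp (-t) * p.1 ≤ 0 := mul_nonpos_of_nonneg_of_nonpos e2.le h
    simp only [max_eq_right h, min_eq_left h, mul_zero, zero_add, abs_of_nonpos h']
    ring

theorem flowV₂_spec : IsPlanarFlowOf flowV₂ (fun p => (p.1, 0)) := fun p t =>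
  ((Real.hasDerivAt_exp t).mul_const p.1).prodMk (hasDerivAt_const t p.2)

theorem flowV₃_spec : IsPlanarFlowOf flowV₃ (fun p => (-p.1, 0)) := by
  intro p t
  refine HasDerivAt.prodMk ?_ (hasDerivAt_const t p.2)
  refine (((hasDerivAt_neg t).exp).mul_const p.1).congr_deriv ?_
  change _ = -(Real.exp (-t) * p.1)
  ring

theorem flowH₁_spec : IsPlanarFlowOf flowH₁ (fun p => (|p.2|, 0)) := by
  intro p t
  refine HasDerivAt.prodMk ?_ (hasDerivAt_const t p.2)
  exact (((hasDerivAt_id t).mul_const |p.2|).const_add p.1).congr_deriv (one_mul _)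

theorem flowH₂_spec : IsPlanarFlowOf flowH₂ (fun p => (p.2, 0)) := by
  intro p t
  refine HasDerivAt.prodMk ?_ (hasDerivAt_const t p.2)
  exact (((hasDerivAt_id t).mul_const p.2).const_add p.1).congr_deriv (one_mul _)

/-! ### Local topological equivalence -/

section

variable {X Y : Type*} [TopologicalSpace X] [TopologicalSpace Y]

/-- The homeomorphism `h : U₁ → U₂` (with `U₁ = h.source`, `U₂ = h.target` open) carries
semi-orbits onto semi-orbits and preserves time directions: if `I` is an interval and the
semi-orbit `Φ_q(I)` lies in `U₁`, then `h` maps it onto a semi-orbit `Ψ_{q'}(J)`, `J = σ(I)` an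
interval, in such a way that `h (Φ_q(t)) = Ψ_{q'}(σ(t))` for a strictly increasing time change
`σ : I → J`. -/
def CarriesSemiOrbits (Φ : Flow ℝ X) (Ψ : Flow ℝ Y) (h : OpenPartialHomeomorph X Y) : Prop :=
  ∀ (q : X) (I : Set ℝ), I.OrdConnected → (∀ t ∈ I, Φ t q ∈ h.source) →
    ∃ (q' : Y) (σ : ℝ → ℝ), StrictMonoOn σ I ∧ (σ '' I).OrdConnected ∧
      ∀ t ∈ I, h (Φ t q) = Ψ (σ t) q'

/-- `Φ` at `p` and `Ψ` at `p'` are locally topologically equivalent: there is a homeomorphism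
between open neighbourhoods of `p` and `p'` that sends `p` to `p'` and makes semi-orbits
correspond to semi-orbits (in both directions), preserving time directions. -/
def LocallyEquivalentAt (Φ : Flow ℝ X) (p : X) (Ψ : Flow ℝ Y) (p' : Y) : Prop :=
  ∃ h : OpenPartialHomeomorph X Y, p ∈ h.source ∧ h p = p' ∧
    CarriesSemiOrbits Φ Ψ h ∧ CarriesSemiOrbits Ψ Φ h.symm

/-! ### Singular points -/

/-- A point is singular if its orbit is a singleton. -/
def IsSingular (Φ : Flow ℝ X) (p : X) : Prop :=
  ∀ t : ℝ, Φ t p = p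

/-- A vertical singular point: locally, a curve of singular points transverse to the flow. -/
def IsVertical (Φ : Flow ℝ X) (p : X) : Prop :=
  IsSingular Φ p ∧ (LocallyEquivalentAt Φ p flowV₁ 0 ∨ LocallyEquivalentAt Φ p flowV₂ 0 ∨
    LocallyEquivalentAt Φ p flowV₃ 0)

/-- A horizontal singular point: locally, a curve of singular points along the flow. -/
def IsHorizontal (Φ : Flow ℝ X) (p : X) : Prop :=
  IsSingular Φ p ∧ (LocallyEquivalentAt Φ p flowH₁ 0 ∨ LocallyEquivalentAt Φ p flowH₂ 0)

/-- The set of essential singular points: those neither vertical nor horizontal. -/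
def essentialSingularSet (Φ : Flow ℝ X) : Set X :=
  {p | IsSingular Φ p ∧ ¬ IsVertical Φ p ∧ ¬ IsHorizontal Φ p}

end

/-! ### Analytic vector fields and their flows -/

section

variable {M : Type*} [TopologicalSpace M] [ChartedSpace (EuclideanSpace ℝ (Fin 2)) M]

/-- The vector field `f` on the surface `M` is (real) analytic, as a section of `TM`. -/
def IsAnalyticVectorField [IsManifold (𝓡 2) ω M] (f : (x : M) → TangentSpace (𝓡 2) x) : Prop :=
  ContMDiff (𝓡 2) (𝓡 2).tangent ω (fun x => (⟨x, f x⟩ : TangentBundle (𝓡 2) M))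

/-- The flow `Φ` is generated by the vector field `f`: each `t ↦ Φ t p` is an integral curve. -/
def IsFlowOf (Φ : Flow ℝ M) (f : (x : M) → TangentSpace (𝓡 2) x) : Prop :=
  ∀ p : M, IsMIntegralCurve (I := 𝓡 2) (fun t => Φ t p) f

end

end SurfaceFlow

end

/-! The question is local: near a zero of an analytic planar field V that is not identically zero,
essential points must not accumulate. A linear change of coordinates makes V not identically zero on
the vertical axis.

Consider an analytic arc x = t^m, y = φ(t) with t > 0, and the coordinates (t, Y), Y = y - φ(t).
Dividing by Y as often as possible gives V = Y^j H, where H is analytic and H(t, 0) is not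
identically zero, hence nonzero for small t > 0. If j = 0, the arc carries no singular point. If j >
0, it is a curve of singular points, and off it the orbits follow the direction of H. The component
of H transverse to the arc is analytic in t: either it is nonzero for all small t > 0, and the
points are vertical, or it vanishes identically, and they are horizontal. This is
`AnalyticChart.eventually_arc_notMem`. The comparison with the models straightens H by an ordinary
differential equation (`exists_flowBox`); the flow then runs along horizontal lines, and a time
change shows that only the sign of its speed matters (`FlowBox.carriesSemiOrbits`).

It remains to pass from arcs to neighbourhoods. `arcsSelectZeros` is a curve selection lemma in
implicit form: a set containing the germ of every such arc contains all zeros with x > 0, near the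
origin, of a function F of finite order n along the vertical axis. The proof is the Newton-Puiseux
algorithm run as an induction on n. A translation in y kills the term of degree n - 1, a side of the
Newton polygon gives a weighted blow-up x = t^m, y = t^k z, and at every z the blown-up function has
order less than n; compactness of the range of z replaces the enumeration of branches. It is applied
to F = |V|² and to the set of non-essential points.

Globally, the identity theorem makes the interior of the singular set clopen. By connectedness it is
all of M, and then f = 0, or it is empty, and then the local result applies at every point. -/

namespace SurfaceFlow

/-! ### Flow boxes and local equivalence through the sign of the speed. -/

section FlowBox

open Set Filter

variable {X Y : Type*} [TopologicalSpace X] [TopologicalSpace Y]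

/-- A chart in which the flow moves along horizontal lines with speed `lam`. -/
structure FlowBox (Φ : Flow ℝ X) (e : OpenPartialHomeomorph X (ℝ × ℝ)) (lam : ℝ × ℝ → ℝ) :
    Prop where
  deriv_zero : ∀ q ∈ e.source, HasDerivAt (fun t => e (Φ t q)) (lam (e q), 0) 0
  cont : ContinuousOn lam e.target
  sing : ∀ q ∈ e.source, lam (e q) = 0 → IsSingular Φ q

/-- Differentiability of a flow at time zero propagates to all times. -/
theorem hasDerivAt_flow_of_zero {E : Type*} [NormedAddCommGroup E] [NormedSpace ℝ E]
    {Φ : Flow ℝ X} {e : X → E} {q : X} {t : ℝ} {v : E}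
    (h : HasDerivAt (fun s => e (Φ s (Φ t q))) v 0) :
    HasDerivAt (fun s => e (Φ s q)) v t := by
  have h1 : HasDerivAt (fun s : ℝ => s - t) 1 t := (hasDerivAt_id t).sub_const t
  have h2 : HasDerivAt (fun s => e (Φ s (Φ t q))) v ((fun s : ℝ => s - t) t) := by simpa using h
  have h3 := HasDerivAt.scomp (h := fun s : ℝ => s - t) t h2 h1
  rw [one_smul] at h3
  refine h3.congr_of_eventuallyEq (Eventually.of_forall fun s => ?_)
  simp only [Function.comp]
  rw [← Flow.map_add, sub_add_cancel]

theorem continuous_orbit (Φ : Flow ℝ X) (q : X) : Continuous fun t => Φ t q :=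
  Φ.continuous continuous_id continuous_const

namespace FlowBox

variable {Φ : Flow ℝ X} {Ψ : Flow ℝ Y} {e : OpenPartialHomeomorph X (ℝ × ℝ)}
  {e' : OpenPartialHomeomorph Y (ℝ × ℝ)} {lam mu : ℝ × ℝ → ℝ}

theorem hasDerivAt (hb : FlowBox Φ e lam) {q : X} {t : ℝ} (h : Φ t q ∈ e.source) :
    HasDerivAt (fun s => e (Φ s q)) (lam (e (Φ t q)), 0) t :=
  hasDerivAt_flow_of_zero (hb.deriv_zero _ h)

theorem hasDerivAt_fst (hb : FlowBox Φ e lam) {q : X} {t : ℝ} (h : Φ t q ∈ e.source) :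
    HasDerivAt (fun s => (e (Φ s q)).1) (lam (e (Φ t q))) t :=
  (hasFDerivAt_fst.comp_hasDerivAt t (hb.hasDerivAt h) :)

theorem hasDerivAt_snd (hb : FlowBox Φ e lam) {q : X} {t : ℝ} (h : Φ t q ∈ e.source) :
    HasDerivAt (fun s => (e (Φ s q)).2) 0 t :=
  (hasFDerivAt_snd.comp_hasDerivAt t (hb.hasDerivAt h) :)

theorem snd_eq (hb : FlowBox Φ e lam) {q : X} {I : Set ℝ} (hI : I.OrdConnected)
    (h : ∀ t ∈ I, Φ t q ∈ e.source) {t₁ t₂ : ℝ} (h₁ : t₁ ∈ I) (h₂ : t₂ ∈ I) :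
    (e (Φ t₁ q)).2 = (e (Φ t₂ q)).2 := by
  have := hI.convex.norm_image_sub_le_of_norm_hasDerivWithin_le (C := 0)
    (fun t ht => (hb.hasDerivAt_snd (h t ht)).hasDerivWithinAt) (by simp) h₂ h₁
  simp only [zero_mul, norm_le_zero_iff] at this
  linarith

/-- A horizontal segment of a flow box free of zeros of the speed lies in a single orbit, the time
being a primitive of the inverse of the speed. -/
theorem flow_symm_eq (hb : FlowBox Φ e lam) {J : Set ℝ} {c : ℝ} (hJ : IsOpen J)
    (hJc : IsPreconnected J) (hmem : ∀ s ∈ J, (s, c) ∈ e.target) (hne : ∀ s ∈ J, lam (s, c) ≠ 0)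
    {τ : ℝ → ℝ} (hτ : ∀ s ∈ J, HasDerivAt τ (lam (s, c))⁻¹ s) {s₀ s : ℝ} (h₀ : s₀ ∈ J)
    (h : s ∈ J) : Φ (τ s - τ s₀) (e.symm (s₀, c)) = e.symm (s, c) := by
  -- The relation "time τ s' - τ s carries (s, c) to (s', c)" is transitive and symmetric, so on a
  -- preconnected set it only has to be checked for s' near s.
  refine hJc.induction₂ (fun s s' => Φ (τ s' - τ s) (e.symm (s, c)) = e.symm (s', c))
    (fun s hs => ?_) (fun x y z _ _ _ hxy hyz => ?_) (fun x y _ _ hxy => ?_) h₀ h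
  · refine Filter.Eventually.filter_mono nhdsWithin_le_nhds ?_
    set q := e.symm (s, c) with hq
    have hqs : q ∈ e.source := e.map_target (hmem s hs)
    have heq : e q = (s, c) := e.right_inv (hmem s hs)
    have hcont := continuous_orbit Φ q
    have hsrc : ∀ᶠ t in 𝓝 (0 : ℝ), Φ t q ∈ e.source := by
      refine hcont.continuousAt.eventually_mem ?_
      simpa using e.open_source.mem_nhds hqs
    have hx0 : (e (Φ 0 q)).1 = s := by simp [heq]
    have hstrict : HasStrictDerivAt (fun t => (e (Φ t q)).1) (lam (e (Φ 0 q))) 0 := by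
      refine hasStrictDerivAt_of_hasDerivAt_of_continuousAt (f' := fun t => lam (e (Φ t q)))
        (hsrc.mono fun t ht => hb.hasDerivAt_fst ht) ?_
      have hsrc0 : Φ 0 q ∈ e.source := by simpa using hqs
      exact ContinuousAt.comp (f := fun t => e (Φ t q))
        (hb.cont.continuousAt (e.open_target.mem_nhds (e.map_source hsrc0)))
        (ContinuousAt.comp (f := fun t => Φ t q) (e.continuousAt hsrc0) hcont.continuousAt)
    -- The speed is nonzero at time 0, so every s' near s is the abscissa of the orbit at a small
    -- time; the claim is pulled back to times.
    have hmap := hstrict.map_nhds_eq (by simpa [heq] using hne s hs)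
    rw [hx0] at hmap
    have hxc : ContinuousAt (fun t => (e (Φ t q)).1) 0 := hstrict.hasDerivAt.continuousAt
    have hxJ : ∀ᶠ t in 𝓝 (0 : ℝ), (e (Φ t q)).1 ∈ J :=
      hxc.eventually_mem (by rw [hx0]; exact hJ.mem_nhds hs)
    rw [← hmap, Filter.eventually_map]
    obtain ⟨η, hη, hball⟩ := Metric.eventually_nhds_iff_ball.1 (hsrc.and hxJ)
    filter_upwards [Metric.ball_mem_nhds (0 : ℝ) hη] with t ht
    have h0 : (0 : ℝ) ∈ Metric.ball (0 : ℝ) η := Metric.mem_ball_self hη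
    have hsnd : ∀ r ∈ Metric.ball (0 : ℝ) η, (e (Φ r q)).2 = c := fun r hr => by
      have := hb.snd_eq (I := Metric.ball (0 : ℝ) η) (convex_ball _ _).ordConnected
        (fun t ht => (hball t ht).1) hr h0
      simpa [heq] using this
    have hform : ∀ r ∈ Metric.ball (0 : ℝ) η, e (Φ r q) = ((e (Φ r q)).1, c) := fun r hr =>
      Prod.ext rfl (hsnd r hr)
    -- The abscissa has derivative lam and τ has derivative 1 / lam: τ along the orbit measures the
    -- elapsed time.
    have hder : ∀ r ∈ Metric.ball (0 : ℝ) η,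
        HasDerivAt (fun r => τ ((e (Φ r q)).1) - r) 0 r := fun r hr => by
      have h1 := (hτ _ (hball r hr).2).comp r (hb.hasDerivAt_fst (hball r hr).1)
      rw [← hform r hr, inv_mul_cancel₀] at h1
      · have h2 := h1.sub (hasDerivAt_id r)
        rw [sub_self] at h2
        exact h2
      · rw [hform r hr]; exact hne _ (hball r hr).2
    have hconst := (convex_ball (0 : ℝ) η).norm_image_sub_le_of_norm_hasDerivWithin_le (C := 0)
      (fun r hr => (hder r hr).hasDerivWithinAt) (by simp) h0 ht
    simp only [zero_mul, norm_le_zero_iff, Flow.map_zero_apply, heq] at hconst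
    have : τ ((e (Φ t q)).1) - τ s = t := by linarith
    simp only [this]
    rw [← hform t ht, e.left_inv (hball t ht).1]
  · rw [← hyz, ← hxy, ← Flow.map_add]
    congr 1; ring
  · rw [← hxy, ← Flow.map_add]
    simp

/-- Two flow boxes with the same image and speeds of the same sign are equivalent. -/
theorem carriesSemiOrbits [Nonempty Y] (hb : FlowBox Φ e lam) (hb' : FlowBox Ψ e' mu)
    (ht : e.target = e'.target)
    (hsign : ∀ p ∈ e.target, SignType.sign (lam p) = SignType.sign (mu p)) :
    CarriesSemiOrbits Φ Ψ (e.trans e'.symm) := by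
  intro q I hI hsrc
  have hsrc : ∀ t ∈ I, Φ t q ∈ e.source := fun t ht => by
    have := hsrc t ht
    rw [OpenPartialHomeomorph.trans_source] at this
    exact this.1
  rcases I.eq_empty_or_nonempty with rfl | ⟨t₀, ht₀⟩
  · exact ⟨Classical.arbitrary Y, id, by simp [StrictMonoOn], by simpa using ordConnected_empty,
      by simp⟩
  have hiff : ∀ p ∈ e.target, lam p = 0 ↔ mu p = 0 := fun p hp => by
    rw [← sign_eq_zero_iff, hsign p hp, sign_eq_zero_iff]
  have htgt : ∀ t ∈ I, e (Φ t q) ∈ e'.target := fun t h => ht ▸ e.map_source (hsrc t h)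
  -- A semi-orbit that meets a zero of the speed is a single point, and so is its image.
  by_cases hz : ∃ t ∈ I, lam (e (Φ t q)) = 0
  · obtain ⟨t₁, h₁, hz⟩ := hz
    have hs := hb.sing _ (hsrc t₁ h₁) hz
    have hconst : ∀ t, Φ t q = Φ t₁ q := fun t => by
      have := hs (t - t₁)
      rwa [← Flow.map_add, sub_add_cancel] at this
    refine ⟨e'.symm (e (Φ t₁ q)), id, strictMono_id.strictMonoOn _, by simpa using hI,
      fun t _ => ?_⟩
    have hs' : IsSingular Ψ (e'.symm (e (Φ t₁ q))) := by
      refine hb'.sing _ (e'.map_target (htgt _ h₁)) ?_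
      rw [e'.right_inv (htgt _ h₁)]
      exact (hiff _ (e.map_source (hsrc t₁ h₁))).1 hz
    rw [hs', hconst t]
    rfl
  push Not at hz
  set c := (e (Φ t₀ q)).2 with hc
  set s₀ := (e (Φ t₀ q)).1 with hs₀
  have hform : ∀ t ∈ I, e (Φ t q) = ((e (Φ t q)).1, c) := fun t h =>
    Prod.ext rfl (hb.snd_eq hI hsrc h ht₀)
  set F : Set ℝ := {s | (s, c) ∈ e'.target ∩ mu ⁻¹' {0}ᶜ} with hF
  have hFo : IsOpen F := by
    have h1 : IsOpen (e'.target ∩ mu ⁻¹' {0}ᶜ) :=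
      hb'.cont.isOpen_inter_preimage e'.open_target isOpen_compl_singleton
    exact h1.preimage (by fun_prop : Continuous fun s : ℝ => (s, c))
  have hxF : ∀ t ∈ I, (e (Φ t q)).1 ∈ F := fun t h => by
    rw [hF, mem_ofPred, ← hform t h]
    exact ⟨htgt t h, fun h' => hz t h ((hiff _ (e.map_source (hsrc t h))).2 h')⟩
  -- The abscissas along the semi-orbit stay in this component, where `mu` has no zero, so that 1 /
  -- mu has a primitive τ on it.
  set J := connectedComponentIn F s₀
  have hJo : IsOpen J := hFo.connectedComponentIn
  have hJF : J ⊆ F := connectedComponentIn_subset F s₀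
  have hJp : IsPreconnected J := isPreconnected_connectedComponentIn
  have hxd : ∀ t ∈ I, HasDerivAt (fun t => (e (Φ t q)).1) (lam (e (Φ t q))) t := fun t h =>
    hb.hasDerivAt_fst (hsrc t h)
  have hxc : ContinuousOn (fun t => (e (Φ t q)).1) I := fun t h =>
    (hxd t h).continuousAt.continuousWithinAt
  have hxJ : ∀ t ∈ I, (e (Φ t q)).1 ∈ J := by
    have h1 : (fun t => (e (Φ t q)).1) '' I ⊆ J :=
      (hI.isPreconnected.image _ hxc).subset_connectedComponentIn ⟨t₀, ht₀, rfl⟩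
        (image_subset_iff.2 hxF)
    exact fun t h => h1 ⟨t, h, rfl⟩
  have hs₀J : s₀ ∈ J := hxJ t₀ ht₀
  have hinv : ContinuousOn (fun s => (mu (s, c))⁻¹) J := by
    refine ContinuousOn.inv₀ (hb'.cont.comp (by fun_prop) fun s hs => (hJF hs).1)
      fun s hs => (hJF hs).2
  set τ : ℝ → ℝ := fun s => ∫ r in s₀..s, (mu (r, c))⁻¹ with hτdef
  have hτ : ∀ s ∈ J, HasDerivAt τ (mu (s, c))⁻¹ s := fun s hs => by
    refine intervalIntegral.integral_hasDerivAt_right ?_ ?_ (hinv.continuousAt (hJo.mem_nhds hs))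
    · exact (hinv.mono (hJp.ordConnected.uIcc_subset hs₀J hs)).intervalIntegrable
    · exact hinv.stronglyMeasurableAtFilter hJo s hs
  -- The time change σ = τ ∘ x has derivative lam / mu, positive because the two speeds have the
  -- same sign.
  have hσd : ∀ t ∈ I, HasDerivAt (fun t => τ (e (Φ t q)).1)
      ((mu (e (Φ t q)))⁻¹ * lam (e (Φ t q))) t := fun t h => by
    have := (hτ _ (hxJ t h)).comp t (hxd t h)
    rwa [← hform t h] at this
  have hσc : ContinuousOn (fun t => τ (e (Φ t q)).1) I := fun t h =>
    (hσd t h).continuousAt.continuousWithinAt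
  refine ⟨e'.symm (s₀, c), fun t => τ (e (Φ t q)).1, ?_, ?_, fun t h => ?_⟩
  · refine strictMonoOn_of_hasDerivWithinAt_pos hI.convex hσc
      (fun t h => (hσd t (interior_subset h)).hasDerivWithinAt) fun t h => ?_
    have h := interior_subset h
    have hs := hsign _ (e.map_source (hsrc t h))
    rcases lt_or_gt_of_ne (hz t h) with hl | hl
    · rw [sign_neg hl, eq_comm, sign_eq_neg_one_iff] at hs
      exact mul_pos_of_neg_of_neg (inv_lt_zero.2 hs) hl
    · rw [sign_pos hl, eq_comm, sign_eq_one_iff] at hs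
      exact mul_pos (inv_pos.2 hs) hl
  · exact (hI.isPreconnected.image _ hσc).ordConnected
  · have := hb'.flow_symm_eq hJo hJp (fun s hs => (hJF hs).1) (fun s hs => (hJF hs).2) hτ hs₀J
      (hxJ t h)
    have h0 : τ s₀ = 0 := by simp [hτdef]
    rw [h0, sub_zero] at this
    simp only [this, OpenPartialHomeomorph.coe_trans, Function.comp]
    rw [hform t h]

theorem restr (hb : FlowBox Φ e lam) {s : Set X} (hs : IsOpen s) :
    FlowBox Φ (e.restrOpen s hs) lam where
  deriv_zero q hq := hb.deriv_zero q hq.1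
  cont := hb.cont.mono fun _ hp => hp.1
  sing q hq := hb.sing q hq.1

/-- Reflection of a flow box in the direction of the flow. -/
theorem reflect (hb : FlowBox Φ e lam) :
    FlowBox Φ (e.trans ((Homeomorph.neg ℝ).prodCongr (Homeomorph.refl ℝ)).toOpenPartialHomeomorph)
      (fun p => -lam (-p.1, p.2)) where
  deriv_zero q hq := by
    have hq : q ∈ e.source := by simpa using hq
    have hq' : Φ 0 q ∈ e.source := by simpa using hq
    have := (hb.hasDerivAt_fst hq').neg.prodMk (hb.hasDerivAt_snd hq')
    simpa [Prod.map] using this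
  cont := by
    have : ContinuousOn (fun p : ℝ × ℝ => lam (-p.1, p.2)) ((fun p : ℝ × ℝ => (-p.1, p.2)) ⁻¹' e.target) :=
      hb.cont.comp (by fun_prop) fun p hp => hp
    refine this.neg.mono fun p hp => ?_
    simpa [Prod.map] using hp
  sing q hq h := by
    have hq : q ∈ e.source := by simpa using hq
    refine hb.sing q hq ?_
    simpa using h

/-- A flow box is locally equivalent to a planar flow along horizontal lines with speed of the same
sign. -/
theorem locallyEquivalentAt {Ψ : Flow ℝ (ℝ × ℝ)} (hb : FlowBox Φ e lam)
    (hb' : FlowBox Ψ (OpenPartialHomeomorph.refl _) mu)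
    (hsign : ∀ p ∈ e.target, SignType.sign (lam p) = SignType.sign (mu p)) {p : X}
    (hp : p ∈ e.source) (h0 : e p = 0) : LocallyEquivalentAt Φ p Ψ 0 := by
  have : Nonempty X := ⟨p⟩
  have hb'' := hb'.restr e.open_target
  have ht : e.target = ((OpenPartialHomeomorph.refl (ℝ × ℝ)).restrOpen _ e.open_target).target := by
    ext; simp [OpenPartialHomeomorph.restrOpen]
  refine ⟨e.trans ((OpenPartialHomeomorph.refl _).restrOpen _ e.open_target).symm, ?_, ?_,
    hb.carriesSemiOrbits hb'' ht hsign, ?_⟩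
  · rw [OpenPartialHomeomorph.trans_source]
    refine ⟨hp, ?_⟩
    rw [OpenPartialHomeomorph.symm_source, ← ht]
    exact e.map_source hp
  · simp [h0]
  · rw [OpenPartialHomeomorph.trans_symm_eq_symm_trans_symm, OpenPartialHomeomorph.symm_symm]
    exact hb''.carriesSemiOrbits hb ht.symm fun q hq => (hsign q (ht ▸ hq)).symm

end FlowBox

/-- A planar flow along horizontal lines is a flow box on the whole plane. -/
theorem flowBox_refl {Ψ : Flow ℝ (ℝ × ℝ)} {mu : ℝ × ℝ → ℝ}
    (h : IsPlanarFlowOf Ψ fun p => (mu p, 0)) (hc : Continuous mu)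
    (hs : ∀ p, mu p = 0 → IsSingular Ψ p) :
    FlowBox Ψ (OpenPartialHomeomorph.refl _) mu where
  deriv_zero q _ := by simpa using h q 0
  cont := hc.continuousOn
  sing q _ hq := hs q hq

theorem flowBox_flowV₁ : FlowBox flowV₁ (OpenPartialHomeomorph.refl _) fun p => |p.1| := by
  refine flowBox_refl flowV₁_spec (by fun_prop) fun p hp t => ?_
  have hp : p.1 = 0 := by simpa using hp
  ext <;> simp [flowV₁, hp]

theorem flowBox_flowV₂ : FlowBox flowV₂ (OpenPartialHomeomorph.refl _) fun p => p.1 := by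
  refine flowBox_refl flowV₂_spec (by fun_prop) fun p hp t => ?_
  have hp : p.1 = 0 := by simpa using hp
  ext <;> simp [flowV₂, hp]

theorem flowBox_flowV₃ : FlowBox flowV₃ (OpenPartialHomeomorph.refl _) fun p => -p.1 := by
  refine flowBox_refl flowV₃_spec (by fun_prop) fun p hp t => ?_
  have hp : p.1 = 0 := by simpa using hp
  ext <;> simp [flowV₃, hp]

theorem flowBox_flowH₁ : FlowBox flowH₁ (OpenPartialHomeomorph.refl _) fun p => |p.2| := by
  refine flowBox_refl flowH₁_spec (by fun_prop) fun p hp t => ?_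
  have hp : p.2 = 0 := by simpa using hp
  ext <;> simp [flowH₁, hp]

theorem flowBox_flowH₂ : FlowBox flowH₂ (OpenPartialHomeomorph.refl _) fun p => p.2 := by
  refine flowBox_refl flowH₂_spec (by fun_prop) fun p hp t => ?_
  have hp : p.2 = 0 := by simpa using hp
  ext <;> simp [flowH₂, hp]

variable {Φ : Flow ℝ X} {e : OpenPartialHomeomorph X (ℝ × ℝ)} {lam : ℝ × ℝ → ℝ} {p : X}

theorem sign_abs_eq_sign_pow {x : ℝ} {j : ℕ} (hj : j ≠ 0) (he : Even j) :
    SignType.sign |x| = SignType.sign (x ^ j) := by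
  rcases eq_or_ne x 0 with rfl | hx
  · simp [hj]
  · rw [sign_pos (abs_pos.2 hx), sign_pos (he.pow_pos hx)]

theorem sign_eq_sign_pow {x : ℝ} {j : ℕ} (ho : Odd j) :
    SignType.sign x = SignType.sign (x ^ j) := by
  rcases lt_trichotomy x 0 with hx | rfl | hx
  · rw [sign_neg hx, sign_neg (ho.pow_neg hx)]
  · simp [ho.pos.ne']
  · rw [sign_pos hx, sign_pos (pow_pos hx j)]

/-- A flow box whose speed vanishes exactly on the vertical axis, with a sign given by a power of
the first coordinate. -/
theorem FlowBox.isVertical (hb : FlowBox Φ e lam) {j : ℕ} (hj : j ≠ 0) {σ : ℝ} (hσ : σ ≠ 0)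
    (hsign : ∀ q ∈ e.target, SignType.sign (lam q) = SignType.sign (σ * q.1 ^ j))
    (hp : p ∈ e.source) (h0 : e p = 0) : IsVertical Φ p := by
  refine ⟨hb.sing p hp ?_, ?_⟩
  · rw [← sign_eq_zero_iff, hsign _ (e.map_source hp), h0]
    simp [hj]
  -- Reflecting x replaces lam(x, y) by -lam(-x, y). This reverses the sign of σ when j is even and
  -- keeps it when j is odd: one model for even j, two (repelling and attracting) for odd j.
  rcases Nat.even_or_odd j with he | ho <;> rcases lt_or_gt_of_ne hσ with hs | hs
  · refine Or.inl (hb.reflect.locallyEquivalentAt flowBox_flowV₁ (fun q hq => ?_) (by simpa using hp)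
      (by simp [h0, Prod.map]))
    have hq' : (-q.1, q.2) ∈ e.target := by simpa [Prod.map] using hq
    have := hsign _ hq'
    rw [sign_mul, sign_neg hs, he.neg_pow] at this
    rw [Left.sign_neg, this, sign_abs_eq_sign_pow hj he]
    simp
  · refine Or.inl (hb.locallyEquivalentAt flowBox_flowV₁ (fun q hq => ?_) hp h0)
    rw [hsign q hq, sign_mul, sign_pos hs, one_mul, sign_abs_eq_sign_pow hj he]
  · refine Or.inr (Or.inr (hb.locallyEquivalentAt flowBox_flowV₃ (fun q hq => ?_) hp h0))
    rw [hsign q hq, sign_mul, sign_neg hs, Left.sign_neg, sign_eq_sign_pow (x := q.1) ho]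
    simp
  · refine Or.inr (Or.inl (hb.locallyEquivalentAt flowBox_flowV₂ (fun q hq => ?_) hp h0))
    rw [hsign q hq, sign_mul, sign_pos hs, one_mul, sign_eq_sign_pow (x := q.1) ho]

/-- A flow box whose speed vanishes exactly on the horizontal axis, with a sign given by a power of
the second coordinate. -/
theorem FlowBox.isHorizontal (hb : FlowBox Φ e lam) {j : ℕ} (hj : j ≠ 0) {σ : ℝ} (hσ : σ ≠ 0)
    (hsign : ∀ q ∈ e.target, SignType.sign (lam q) = SignType.sign (σ * q.2 ^ j))
    (hp : p ∈ e.source) (h0 : e p = 0) : IsHorizontal Φ p := by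
  refine ⟨hb.sing p hp ?_, ?_⟩
  · rw [← sign_eq_zero_iff, hsign _ (e.map_source hp), h0]
    simp [hj]
  -- The reflection does not touch y, so it reverses the sign of σ for either parity of j; two
  -- models are enough.
  have hneg : σ < 0 → ∀ q ∈ (e.trans ((Homeomorph.neg ℝ).prodCongr
      (Homeomorph.refl ℝ)).toOpenPartialHomeomorph).target,
      SignType.sign (-lam (-q.1, q.2)) = SignType.sign (q.2 ^ j) := fun hs q hq => by
    have hq' : (-q.1, q.2) ∈ e.target := by simpa [Prod.map] using hq
    have := hsign _ hq'
    rw [sign_mul, sign_neg hs] at this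
    rw [Left.sign_neg, this]
    simp
  have hpos : 0 < σ → ∀ q ∈ e.target, SignType.sign (lam q) = SignType.sign (q.2 ^ j) :=
    fun hs q hq => by rw [hsign q hq, sign_mul, sign_pos hs, one_mul]
  rcases Nat.even_or_odd j with he | ho <;> rcases lt_or_gt_of_ne hσ with hs | hs
  · refine Or.inl (hb.reflect.locallyEquivalentAt flowBox_flowH₁ (fun q hq => ?_) (by simpa using hp)
      (by simp [h0, Prod.map]))
    rw [hneg hs q hq, sign_abs_eq_sign_pow hj he]
  · refine Or.inl (hb.locallyEquivalentAt flowBox_flowH₁ (fun q hq => ?_) hp h0)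
    rw [hpos hs q hq, sign_abs_eq_sign_pow hj he]
  · refine Or.inr (hb.reflect.locallyEquivalentAt flowBox_flowH₂ (fun q hq => ?_) (by simpa using hp)
      (by simp [h0, Prod.map]))
    rw [hneg hs q hq, sign_eq_sign_pow (x := q.2) ho]
  · refine Or.inr (hb.locallyEquivalentAt flowBox_flowH₂ (fun q hq => ?_) hp h0)
    rw [hpos hs q hq, sign_eq_sign_pow (x := q.2) ho]

end FlowBox

end SurfaceFlow

namespace SurfaceFlow

/-! ### Straightening a Lipschitz direction field (1, k). -/

section Straightening

open Set Filter Metric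
open scoped NNReal

/-- The local flow of a scalar, time-dependent, Lipschitz differential equation, on a rectangle. -/
theorem exists_scalar_local_flow {k : ℝ × ℝ → ℝ} {K : ℝ≥0} {N : Set (ℝ × ℝ)} (hN : N ∈ 𝓝 0)
    (hk : LipschitzOnWith K k N) :
    ∃ ε > 0, Ioo (-ε) ε ×ˢ Ioo (-ε) ε ⊆ N ∧ ∃ α : ℝ × ℝ → ℝ, ContinuousOn α (Ioo (-ε) ε ×ˢ Ioo (-ε) ε) ∧
      (∀ c ∈ Ioo (-ε) ε, α (0, c) = c) ∧
      ∀ p ∈ Ioo (-ε) ε ×ˢ Ioo (-ε) ε, (p.1, α p) ∈ N ∧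
        HasDerivAt (fun s => α (s, p.2)) (k (p.1, α p)) p.1 := by
  obtain ⟨b, hb, hbN⟩ := nhds_basis_closedBall.mem_iff.1 hN
  have hmem : ∀ s u : ℝ, |s| ≤ b → |u| ≤ b → (s, u) ∈ N := fun s u hs hu =>
    hbN (by simp [Prod.norm_def, hs, hu])
  lift b to ℝ≥0 using hb.le with b'
  -- A bound for |k| on the closed ball of radius b'; the summand 1 makes it positive, so that one
  -- can divide by it. For times up to b' / 2 / L, solutions starting within b' / 2 stay within b'.
  set L : ℝ≥0 := ‖k 0‖₊ + K * b' + 1 with hL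
  have hLpos : (0 : ℝ) < L := by positivity
  have hkL : ∀ p ∈ closedBall (0 : ℝ × ℝ) b', ‖k p‖ ≤ L := fun p hp => by
    have h1 := hk.dist_le_mul p (hbN hp) 0 (hbN (mem_closedBall_self hb.le))
    rw [dist_eq_norm] at h1
    have h2 : ‖k p‖ ≤ ‖k p - k 0‖ + ‖k 0‖ := by
      simpa using norm_add_le (k p - k 0) (k 0)
    have h3 : (K : ℝ) * dist p 0 ≤ K * b' := by gcongr; exact hp
    have h4 : (L : ℝ) = ‖k 0‖ + K * b' + 1 := by simp [hL]
    linarith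
  set ε₀ : ℝ := min b' (b' / 2 / L) with hε₀
  have hε₀pos : 0 < ε₀ := lt_min hb (by positivity)
  have hε₀b : ε₀ ≤ b' := min_le_left _ _
  have hPL : IsPicardLindelof (fun s u => k (s, u)) (tmin := -ε₀) (tmax := ε₀)
      ⟨0, by simp [hε₀pos.le]⟩ 0 b' (b' / 2) L K := by
    refine ⟨fun t ht => ?_, fun x hx => ?_, fun t ht x hx => ?_, ?_⟩
    · refine LipschitzOnWith.of_dist_le_mul fun x hx y hy => ?_
      have ht' : |t| ≤ b' := (abs_le.2 ht).trans hε₀b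
      have := hk.dist_le_mul (t, x) (hmem _ _ ht' (by simpa using hx)) (t, y)
        (hmem _ _ ht' (by simpa using hy))
      simpa [Prod.dist_eq] using this
    · refine hk.continuousOn.comp (by fun_prop) fun t ht => ?_
      exact hmem _ _ ((abs_le.2 ht).trans hε₀b) (by simpa using hx)
    · refine hkL _ ?_
      have ht' : |t| ≤ b' := (abs_le.2 ht).trans hε₀b
      have hx' : |x| ≤ b' := by simpa using hx
      simp [Prod.norm_def, ht', hx']
    · have : ε₀ ≤ b' / 2 / L := min_le_right _ _
      rw [le_div_iff₀ hLpos] at this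
      simp only [sub_zero, zero_sub, neg_neg, max_self, NNReal.coe_div, NNReal.coe_ofNat]
      linarith
  obtain ⟨β, hβ, hβc⟩ := hPL.exists_forall_mem_closedBall_eq_hasDerivWithinAt_continuousOn
  have hr : ((b' / 2 : ℝ≥0) : ℝ) = b' / 2 := by simp
  rw [hr] at hβ hβc
  set α : ℝ × ℝ → ℝ := fun p => β (p.2, p.1) with hα
  have hαc : ContinuousOn α (Icc (-ε₀) ε₀ ×ˢ closedBall 0 (b' / 2)) :=
    hβc.comp (by fun_prop) fun p hp => ⟨hp.2, hp.1⟩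
  have hnhds : Icc (-ε₀) ε₀ ×ˢ closedBall (0 : ℝ) (b' / 2) ∈ 𝓝 (0 : ℝ × ℝ) :=
    prod_mem_nhds (Icc_mem_nhds (by simpa using hε₀pos) (by simpa using hε₀pos))
      (closedBall_mem_nhds _ (by positivity))
  have h00 : α 0 = 0 := (hβ 0 (mem_closedBall_self (by positivity))).1
  have hev : ∀ᶠ p in 𝓝 (0 : ℝ × ℝ), (p.1, α p) ∈ N := by
    have hca : ContinuousAt (fun p : ℝ × ℝ => (p.1, α p)) 0 :=
      continuousAt_fst.prodMk (hαc.continuousAt hnhds)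
    refine hca.eventually_mem ?_
    rw [h00]; exact hN
  have hall : ∀ᶠ p in 𝓝 (0 : ℝ × ℝ), ((p.1, α p) ∈ N ∧ p ∈ N) ∧
      p ∈ Ioo (-ε₀) ε₀ ×ˢ closedBall (0 : ℝ) (b' / 2) :=
    (hev.and hN).and (prod_mem_nhds (Ioo_mem_nhds (by simpa using hε₀pos) (by simpa using hε₀pos))
      (closedBall_mem_nhds _ (by positivity)))
  obtain ⟨ε, hε, hball⟩ := Metric.eventually_nhds_iff_ball.1 hall
  have hR : ∀ p ∈ Ioo (-ε) ε ×ˢ Ioo (-ε) ε, p ∈ ball (0 : ℝ × ℝ) ε := fun p hp => by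
    simp only [mem_ball, dist_zero_right, Prod.norm_def, Real.norm_eq_abs, sup_lt_iff]
    exact ⟨abs_lt.2 hp.1, abs_lt.2 hp.2⟩
  refine ⟨ε, hε, fun p hp => (hball p (hR p hp)).1.2, α, hαc.mono fun p hp => ?_, fun c hc => ?_, fun p hp => ?_⟩
  · have := (hball p (hR p hp)).2
    exact ⟨Ioo_subset_Icc_self this.1, this.2⟩
  · have := (hball (0, c) (hR (0, c) ⟨by simpa using hε, hc⟩)).2
    exact (hβ c this.2).1
  · obtain ⟨⟨h1, -⟩, h2⟩ := hball p (hR p hp)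
    refine ⟨h1, ?_⟩
    have := (hβ p.2 h2.2).2 p.1 (Ioo_subset_Icc_self h2.1)
    exact this.hasDerivAt (Icc_mem_nhds h2.1.1 h2.1.2)

/-- The curves of `u' = k (s, u)` are straightened by a homeomorphism preserving `s`. -/
theorem exists_straightening {k : ℝ × ℝ → ℝ} {K : ℝ≥0} {N : Set (ℝ × ℝ)} (hN : N ∈ 𝓝 0)
    (hk : LipschitzOnWith K k N) :
    ∃ E : OpenPartialHomeomorph (ℝ × ℝ) (ℝ × ℝ), 0 ∈ E.source ∧ E 0 = 0 ∧
      (∀ p, (E p).1 = p.1) ∧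
      (∀ p ∈ E.source, E p ∈ N ∧ HasDerivAt (fun s => (E (s, p.2)).2) (k (E p)) p.1) ∧
      ((∀ s, (s, 0) ∈ N → k (s, 0) = 0) →
        ∀ p ∈ E.source, SignType.sign (E p).2 = SignType.sign p.2) := by
  obtain ⟨ε, hε, hRN, α, hαc, hα0, hα⟩ := exists_scalar_local_flow hN hk
  set R : Set (ℝ × ℝ) := Ioo (-ε) ε ×ˢ Ioo (-ε) ε with hR
  have hRo : IsOpen R := isOpen_Ioo.prod isOpen_Ioo
  have h0I : (0 : ℝ) ∈ Ioo (-ε) ε := by simpa using hε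
  have hlip : ∀ t, LipschitzOnWith K (fun u => k (t, u)) {u | (t, u) ∈ N} := fun t =>
    LipschitzOnWith.of_dist_le_mul fun x hx y hy => by
      simpa [Prod.dist_eq] using hk.dist_le_mul (t, x) hx (t, y) hy
  -- Two solution curves that meet coincide, so they never cross and their order at s = 0 persists.
  have huniq : ∀ s ∈ Ioo (-ε) ε, ∀ c ∈ Ioo (-ε) ε, ∀ c' ∈ Ioo (-ε) ε,
      α (s, c) = α (s, c') → c = c' := fun s hs c hc c' hc' h => by
    have := ODE_solution_unique_of_mem_Ioo (v := fun t u => k (t, u)) (s := fun t => {u | (t, u) ∈ N})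
      (f := fun t => α (t, c)) (g := fun t => α (t, c')) (fun t _ => hlip t) hs
      (fun t ht => ⟨(hα (t, c) ⟨ht, hc⟩).2, (hα (t, c) ⟨ht, hc⟩).1⟩)
      (fun t ht => ⟨(hα (t, c') ⟨ht, hc'⟩).2, (hα (t, c') ⟨ht, hc'⟩).1⟩) h h0I
    simpa [hα0 c hc, hα0 c' hc'] using this
  have hmono : ∀ s ∈ Ioo (-ε) ε, ∀ c ∈ Ioo (-ε) ε, ∀ c' ∈ Ioo (-ε) ε, c < c' →
      α (s, c) < α (s, c') := fun s hs c hc c' hc' hlt => by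
    have hcont : ContinuousOn (fun t => α (t, c') - α (t, c)) (Ioo (-ε) ε) :=
      (hαc.comp (by fun_prop) fun t ht => ⟨ht, hc'⟩).sub
        (hαc.comp (by fun_prop) fun t ht => ⟨ht, hc⟩)
    have hnz : ∀ t ∈ Ioo (-ε) ε, α (t, c') - α (t, c) ≠ 0 := fun t ht h =>
      hlt.ne' (huniq t ht c' hc' c hc (sub_eq_zero.1 h))
    by_contra hge
    obtain ⟨t, ht, h0⟩ := isPreconnected_Ioo.intermediate_value hs h0I hcont
      (show (0 : ℝ) ∈ Icc _ _ by
        simp only [hα0 c hc, hα0 c' hc', mem_Icc]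
        constructor <;> linarith)
    exact hnz t ht h0
  set f : ℝ × ℝ → ℝ × ℝ := fun p => (p.1, α p) with hf
  have hinj : InjOn f R := by
    rintro ⟨s, c⟩ h ⟨s', c'⟩ h' heq
    simp only [hf, Prod.mk.injEq] at heq
    obtain ⟨rfl, heq⟩ := heq
    rw [huniq s h.1 c h.2 c' h'.2 heq]
  -- Monotonicity in c and the intermediate value theorem give openness; differentiable dependence
  -- on the initial value is not needed.
  have hopen : ∀ U ⊆ R, IsOpen U → IsOpen (f '' U) := fun U hUR hU => by
    rw [isOpen_iff_mem_nhds]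
    rintro _ ⟨⟨s₀, c₀⟩, hp, rfl⟩
    obtain ⟨η, hη, hball⟩ := nhds_basis_closedBall.mem_iff.1 (hU.mem_nhds hp)
    have hmem : ∀ s c, |s - s₀| ≤ η → |c - c₀| ≤ η → (s, c) ∈ U := fun s c hs hc =>
      hball (by simp [Prod.dist_eq, Real.dist_eq, hs, hc])
    have hm : (s₀, c₀ - η) ∈ R := hUR (hmem _ _ (by simp [hη.le]) (by simp [abs_of_pos hη]))
    have hp : (s₀, c₀ + η) ∈ R := hUR (hmem _ _ (by simp [hη.le]) (by simp [abs_of_pos hη]))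
    have hc₀ : (s₀, c₀) ∈ R := hUR (hmem _ _ (by simp [hη.le]) (by simp [hη.le]))
    have h1 : ContinuousAt (fun q : ℝ × ℝ => α (q.1, c₀ - η)) (s₀, α (s₀, c₀)) :=
      ContinuousAt.comp (f := fun q : ℝ × ℝ => (q.1, c₀ - η)) (x := (s₀, α (s₀, c₀)))
        (hαc.continuousAt (hRo.mem_nhds hm)) (by fun_prop)
    have h2 : ContinuousAt (fun q : ℝ × ℝ => α (q.1, c₀ + η)) (s₀, α (s₀, c₀)) :=
      ContinuousAt.comp (f := fun q : ℝ × ℝ => (q.1, c₀ + η)) (x := (s₀, α (s₀, c₀)))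
        (hαc.continuousAt (hRo.mem_nhds hp)) (by fun_prop)
    have h3 : ∀ᶠ q : ℝ × ℝ in 𝓝 (s₀, α (s₀, c₀)), |q.1 - s₀| ≤ η := by
      have : ContinuousAt (fun q : ℝ × ℝ => |q.1 - s₀|) (s₀, α (s₀, c₀)) := by fun_prop
      exact (this.eventually (gt_mem_nhds (by simpa using hη))).mono fun q hq => le_of_lt hq
    have h4 := h1.eventually_lt continuousAt_snd (hmono s₀ hm.1 _ hm.2 _ hc₀.2 (by linarith))
    have h5 := continuousAt_snd.eventually_lt h2 (hmono s₀ hm.1 _ hc₀.2 _ hp.2 (by linarith))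
    filter_upwards [h3, h4, h5] with q hq3 hq4 hq5
    have hcont : ContinuousOn (fun c => α (q.1, c)) (Icc (c₀ - η) (c₀ + η)) := by
      refine hαc.comp (by fun_prop) fun c hc => hUR (hmem _ _ hq3 ?_)
      rw [abs_le]; constructor <;> linarith [hc.1, hc.2]
    obtain ⟨c, hc, hcq⟩ := intermediate_value_Icc (by linarith) hcont ⟨hq4.le, hq5.le⟩
    refine ⟨(q.1, c), hmem _ _ hq3 ?_, Prod.ext rfl hcq⟩
    rw [abs_le]; constructor <;> linarith [hc.1, hc.2]
  have hcont : ContinuousOn f R := continuousOn_fst.prodMk hαc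
  have homap : IsOpenMap (R.domRestrict f) := fun V hV => by
    rw [show R.domRestrict f = f ∘ Subtype.val from rfl, image_comp]
    exact hopen _ (by rintro _ ⟨x, _, rfl⟩; exact x.2) (hRo.isOpenMap_subtype_val V hV)
  refine ⟨OpenPartialHomeomorph.ofContinuousOpenRestrict (hinj.toPartialEquiv f R) hcont homap hRo,
    ⟨h0I, h0I⟩, ?_, fun p => rfl, fun p hp => ⟨(hα p hp).1, (hα p hp).2⟩, fun h0 p hp => ?_⟩
  · exact Prod.ext rfl (hα0 0 h0I)
  · change SignType.sign (α p) = _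
    have hp : p ∈ R := hp
    -- When k vanishes on the axis, the axis is a solution curve, and the others stay on their side
    -- of it.
    have hN0 : ∀ s ∈ Ioo (-ε) ε, α (s, 0) = 0 := fun s hs => by
      have hmem : ∀ t ∈ Ioo (-ε) ε, (t, (0 : ℝ)) ∈ N := fun t ht => hRN ⟨ht, h0I⟩
      exact ODE_solution_unique_of_mem_Ioo (v := fun t u => k (t, u))
        (s := fun t => {u | (t, u) ∈ N}) (f := fun t => α (t, 0)) (g := fun _ => 0)
        (fun t _ => hlip t) h0I
        (fun t ht => ⟨(hα (t, 0) ⟨ht, h0I⟩).2, (hα (t, 0) ⟨ht, h0I⟩).1⟩)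
        (fun t ht => ⟨by rw [h0 t (hmem t ht)]; exact hasDerivAt_const _ _, hmem t ht⟩)
        (hα0 0 h0I) hs
    rcases lt_trichotomy p.2 0 with h | h | h
    · have := hmono p.1 hp.1 p.2 hp.2 0 h0I h
      rw [hN0 p.1 hp.1] at this
      rw [sign_neg h, sign_neg this]
    · have := hN0 p.1 hp.1
      rw [← h] at this
      rw [show p = (p.1, p.2) from rfl, this, h]
    · have := hmono p.1 hp.1 0 h0I p.2 hp.2 h
      rw [hN0 p.1 hp.1] at this
      rw [sign_pos h, sign_pos this]

end Straightening

end SurfaceFlow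

namespace SurfaceFlow

/-! ### From a direction field tangent to the flow to a flow box. -/

section BoxExistence

open Set Filter
open scoped NNReal

variable {X : Type*} [TopologicalSpace X]

/-- In a chart where the flow is tangent to the direction field `(1, k)`, straightening this
direction field yields a flow box. -/
theorem exists_flowBox {Φ : Flow ℝ X} {g : OpenPartialHomeomorph X (ℝ × ℝ)} {lam k : ℝ × ℝ → ℝ}
    {p : X} (hp : p ∈ g.source) (h0 : g p = 0)
    (hd : ∀ q ∈ g.source, HasDerivAt (fun t => g (Φ t q)) (lam (g q), lam (g q) * k (g q)) 0)
    (hlam : ContinuousOn lam g.target) (hs : ∀ q ∈ g.source, lam (g q) = 0 → IsSingular Φ q)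
    (hk : ContDiffAt ℝ 1 k 0) :
    ∃ (E : ℝ × ℝ → ℝ × ℝ) (e : OpenPartialHomeomorph X (ℝ × ℝ)),
      FlowBox Φ e (fun q => lam (E q)) ∧ p ∈ e.source ∧ e p = 0 ∧
      (∀ q ∈ e.target, E q ∈ g.target) ∧ (∀ q, (E q).1 = q.1) ∧
      ((∀ᶠ s in 𝓝 (0 : ℝ), k (s, 0) = 0) →
        ∀ q ∈ e.target, SignType.sign (E q).2 = SignType.sign q.2) := by
  obtain ⟨K, N₀, hN₀, hlip₀⟩ := hk.exists_lipschitzOnWith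
  -- The local vanishing of k on the axis enters as an implication, so that a single neighbourhood
  -- serves whether or not it holds.
  set S : Set (ℝ × ℝ) := {q | (∀ᶠ s in 𝓝 (0 : ℝ), k (s, 0) = 0) → k (q.1, 0) = 0} with hS
  have hSn : S ∈ 𝓝 (0 : ℝ × ℝ) := by
    by_cases h : ∀ᶠ s in 𝓝 (0 : ℝ), k (s, 0) = 0
    · have : ∀ᶠ q : ℝ × ℝ in 𝓝 0, k (q.1, 0) = 0 :=
        (continuousAt_fst (p := (0 : ℝ × ℝ))).eventually h
      exact this.mono fun q hq _ => hq
    · exact Filter.Eventually.of_forall fun q hq => absurd hq h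
  set N := N₀ ∩ S with hN
  have hNn : N ∈ 𝓝 (0 : ℝ × ℝ) := inter_mem hN₀ hSn
  have hlip : LipschitzOnWith K k N := hlip₀.mono inter_subset_left
  obtain ⟨E, hE0s, hE0, hE1, hE, hEsign⟩ := exists_straightening hNn hlip
  have hE0' : E.symm 0 = 0 := by rw [← hE0, E.left_inv hE0s, hE0]
  have htgt : ∀ q ∈ (g.trans E.symm).target, q ∈ E.source ∧ E q ∈ g.target := fun q hq => by
    simpa [OpenPartialHomeomorph.trans_target] using hq
  have hsrc : ∀ q ∈ (g.trans E.symm).source, q ∈ g.source ∧ g q ∈ E.target := fun q hq => by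
    simpa [OpenPartialHomeomorph.trans_source] using hq
  refine ⟨E, g.trans E.symm, ⟨fun q hq => ?_, ?_, fun q hq h => ?_⟩, ?_, ?_, fun q hq => (htgt q hq).2,
    hE1, fun h q hq => ?_⟩
  · obtain ⟨hqg, hqE⟩ := hsrc q hq
    set c := (E.symm (g q)).2 with hc
    have hΦ0 : Φ 0 q = q := Flow.map_zero_apply Φ q
    have hcont := continuous_orbit Φ q
    have hev : ∀ᶠ t in 𝓝 (0 : ℝ), Φ t q ∈ (g.trans E.symm).source :=
      hcont.continuousAt.eventually_mem
        (by rw [hΦ0]; exact (g.trans E.symm).open_source.mem_nhds hq)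
    have hder : ∀ᶠ t in 𝓝 (0 : ℝ), HasDerivAt (fun t => g (Φ t q))
        (lam (g (Φ t q)), lam (g (Φ t q)) * k (g (Φ t q))) t :=
      hev.mono fun t ht => hasDerivAt_flow_of_zero (hd _ (hsrc _ ht).1)
    have hd1 : ∀ᶠ t in 𝓝 (0 : ℝ), HasDerivAt (fun t => (g (Φ t q)).1) (lam (g (Φ t q))) t :=
      hder.mono fun t ht => (hasFDerivAt_fst.comp_hasDerivAt t ht :)
    have hd2 : ∀ᶠ t in 𝓝 (0 : ℝ), HasDerivAt (fun t => (g (Φ t q)).2)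
        (lam (g (Φ t q)) * k (g (Φ t q))) t :=
      hder.mono fun t ht => (hasFDerivAt_snd.comp_hasDerivAt t ht :)
    have hEsymm : E.symm (g q) = ((g q).1, c) := by
      refine Prod.ext ?_ rfl
      rw [← hE1, E.right_inv hqE]
    have hmem0 : ((g q).1, c) ∈ E.source := by rw [← hEsymm]; exact E.map_target hqE
    have hγc : ContinuousAt (fun t => g (Φ t q)) 0 := hder.self_of_nhds.continuousAt
    have hmem : ∀ᶠ t in 𝓝 (0 : ℝ), ((g (Φ t q)).1, c) ∈ E.source := by
      have : ContinuousAt (fun t => ((g (Φ t q)).1, c)) 0 := hγc.fst.prodMk continuousAt_const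
      refine this.eventually_mem ?_
      rw [hΦ0]; exact E.open_source.mem_nhds hmem0
    have hbound : ∀ᶠ t in 𝓝 (0 : ℝ), ‖lam (g (Φ t q))‖₊ ≤ ‖lam (g q)‖₊ + 1 := by
      have : ContinuousAt (fun t => ‖lam (g (Φ t q))‖₊) 0 := by
        refine ContinuousAt.nnnorm (ContinuousAt.comp (f := fun t => g (Φ t q)) ?_ hγc)
        rw [hΦ0]
        exact hlam.continuousAt (g.open_target.mem_nhds (g.map_source hqg))
      refine (this.eventually_lt continuousAt_const ?_).mono fun t ht => ht.le
      rw [hΦ0]; exact lt_add_one _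
    -- The ordinate of the orbit, and the ordinate of the straightened curve through q above the
    -- abscissa of the orbit, solve the same equation u' = lam(t) k(x(t), u). Hence the orbit stays
    -- on that curve. Nothing is divided by the speed, so points where it vanishes are covered.
    have huniq := ODE_solution_unique_of_eventually (t₀ := (0 : ℝ))
      (v := fun t u => lam (g (Φ t q)) * k ((g (Φ t q)).1, u))
      (s := fun t => {u | ((g (Φ t q)).1, u) ∈ N}) (K := (‖lam (g q)‖₊ + 1) * K)
      (f := fun t => (E ((g (Φ t q)).1, c)).2) (g := fun t => (g (Φ t q)).2)
      (hbound.mono fun t ht => LipschitzOnWith.of_dist_le_mul fun x hx y hy => by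
        have h1 := hlip.dist_le_mul _ hx _ hy
        simp only [Prod.dist_eq, dist_self, dist_nonneg, sup_of_le_right] at h1
        have h2 : |lam (g (Φ t q))| ≤ ‖lam (g q)‖₊ + 1 := ht
        rw [dist_eq_norm, ← mul_sub, norm_mul, ← dist_eq_norm, NNReal.coe_mul, mul_assoc]
        exact mul_le_mul h2 h1 dist_nonneg (by positivity))
      (by
        filter_upwards [hmem, hd1] with t ht ht1
        obtain ⟨hEN, hEd⟩ := hE _ ht
        have hform : E ((g (Φ t q)).1, c) = ((g (Φ t q)).1, (E ((g (Φ t q)).1, c)).2) :=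
          Prod.ext (hE1 _) rfl
        refine ⟨?_, ?_⟩
        · have h3 := HasDerivAt.comp (h := fun t => (g (Φ t q)).1) t hEd ht1
          rw [mul_comm] at h3
          rw [← hform]
          exact h3
        · rw [← hform]; exact hEN)
      (by
        filter_upwards [hev, hd2] with t ht ht2
        refine ⟨ht2, ?_⟩
        have h4 := (hE _ (E.map_target (hsrc _ ht).2)).1
        rw [E.right_inv (hsrc _ ht).2] at h4
        exact h4)
      (by
        simp only [hΦ0]
        rw [← hEsymm, E.right_inv hqE])
    have hfinal : (fun t => (g.trans E.symm) (Φ t q)) =ᶠ[𝓝 0] fun t => ((g (Φ t q)).1, c) := by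
      filter_upwards [huniq, hmem] with t ht hm
      have : E ((g (Φ t q)).1, c) = g (Φ t q) := Prod.ext (hE1 _) ht
      change E.symm (g (Φ t q)) = _
      rw [← this, E.left_inv hm, this]
    have hres := (hd1.self_of_nhds.prodMk (hasDerivAt_const (0 : ℝ) c)).congr_of_eventuallyEq hfinal
    rw [hΦ0] at hres
    change HasDerivAt _ (lam (E (E.symm (g q))), (0 : ℝ)) 0
    rw [E.right_inv hqE]
    exact hres
  · exact hlam.comp (E.continuousOn.mono fun q hq => (htgt q hq).1) fun q hq => (htgt q hq).2
  · obtain ⟨hqg, hqE⟩ := hsrc q hq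
    refine hs q hqg ?_
    change lam (E (E.symm (g q))) = 0 at h
    rwa [E.right_inv hqE] at h
  · rw [OpenPartialHomeomorph.trans_source]
    refine ⟨hp, ?_⟩
    change g p ∈ E.target
    rw [h0, ← hE0]
    exact E.map_source hE0s
  · change E.symm (g p) = 0
    rw [h0, hE0']
  · exact hEsign (fun s hsN => hsN.2 h) q (htgt q hq).1

end BoxExistence

end SurfaceFlow

namespace SurfaceFlow

/-! ### Curves of zeros: vertical and horizontal points. -/

section Essential

open Set Filter

variable {X : Type*} [TopologicalSpace X] {Φ : Flow ℝ X} {g : OpenPartialHomeomorph X (ℝ × ℝ)}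
  {p : X} {t₀ : ℝ} {j : ℕ} {A B : ℝ × ℝ → ℝ}

/-- The translation of the plane along the first axis. -/
def shiftHomeomorph (t₀ : ℝ) : ℝ × ℝ ≃ₜ ℝ × ℝ :=
  (Homeomorph.subRight t₀).prodCongr (Homeomorph.refl ℝ)

/-- A curve of singular points transverse to the direction of the flow. -/
theorem isVertical_of_transverse (hp : p ∈ g.source) (hgp : g p = (t₀, 0)) (hj : j ≠ 0)
    (hd : ∀ q ∈ g.source,
      HasDerivAt (fun t => g (Φ t q)) ((g q).2 ^ j * A (g q), (g q).2 ^ j * B (g q)) 0)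
    (hs : ∀ q ∈ g.source, (g q).2 = 0 → IsSingular Φ q)
    (hA : AnalyticAt ℝ A (t₀, 0)) (hB : AnalyticAt ℝ B (t₀, 0)) (hB0 : B (t₀, 0) ≠ 0) :
    IsVertical Φ p := by
  have hev : ∀ᶠ q in 𝓝 (t₀, (0 : ℝ)), AnalyticAt ℝ B q ∧ 0 < B (t₀, 0) * B q := by
    refine hB.eventually_analyticAt.and ?_
    exact continuousAt_const.eventually_lt (continuousAt_const.mul hB.continuousAt)
      (mul_self_pos.2 hB0)
  obtain ⟨W, hW, hWo, hpW⟩ := eventually_nhds_iff.1 hev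
  have hWB : ∀ q ∈ W, B q ≠ 0 := fun q hq h => by simpa [h] using (hW q hq).2
  -- The coordinates are exchanged: B is nonzero, so the direction field becomes (1, A / B), and the
  -- curve of zeros becomes the vertical axis.
  set L : ℝ × ℝ ≃ₜ ℝ × ℝ := (shiftHomeomorph t₀).trans (Homeomorph.prodComm ℝ ℝ) with hL
  have hLa : ∀ q, L q = (q.2, q.1 - t₀) := fun q => rfl
  have hLs : ∀ q, L.symm q = (q.2 + t₀, q.1) := fun q => rfl
  set g' := (g.trans (OpenPartialHomeomorph.ofSet W hWo)).trans L.toOpenPartialHomeomorph with hg'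
  have hsrc : ∀ q ∈ g'.source, q ∈ g.source ∧ g q ∈ W := fun q hq => by simpa [hg'] using hq
  have htgt : ∀ q ∈ g'.target, (q.2 + t₀, q.1) ∈ W := fun q hq => by
    have : L.symm q ∈ W := by
      simp [hg'] at hq
      exact hq.1
    exact this
  have hg'a : ∀ q, g' q = ((g q).2, (g q).1 - t₀) := fun q => rfl
  have hlin : AnalyticAt ℝ (fun q : ℝ × ℝ => (q.2 + t₀, q.1)) 0 :=
    (analyticAt_snd.add analyticAt_const).prod analyticAt_fst
  have hkA : AnalyticAt ℝ (fun q : ℝ × ℝ => A (q.2 + t₀, q.1)) 0 :=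
    AnalyticAt.fun_comp (by simpa using hA) hlin
  have hkB : AnalyticAt ℝ (fun q : ℝ × ℝ => B (q.2 + t₀, q.1)) 0 :=
    AnalyticAt.fun_comp (by simpa using hB) hlin
  have hk : AnalyticAt ℝ (fun q : ℝ × ℝ => A (q.2 + t₀, q.1) / B (q.2 + t₀, q.1)) 0 :=
    hkA.div hkB (by simpa using hB0)
  obtain ⟨E, e, hbox, hpe, hep, hEt, hE1, -⟩ := exists_flowBox (Φ := Φ) (g := g')
    (lam := fun q => q.1 ^ j * B (q.2 + t₀, q.1)) (p := p) (by simp [hg', hp, hgp, hpW])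
    (by rw [hg'a, hgp]; simp)
    (k := fun q : ℝ × ℝ => A (q.2 + t₀, q.1) / B (q.2 + t₀, q.1))
    (fun q hq => by
      obtain ⟨hq1, hq2⟩ := hsrc q hq
      have h := hd q hq1
      have h1 : HasDerivAt (fun t => (g (Φ t q)).1) _ 0 := hasFDerivAt_fst.comp_hasDerivAt _ h
      have h2 : HasDerivAt (fun t => (g (Φ t q)).2) _ 0 := hasFDerivAt_snd.comp_hasDerivAt _ h
      have h3 := h2.prodMk (h1.sub_const t₀)
      simp only [hg'a, sub_add_cancel, Prod.mk.eta]
      refine h3.congr_deriv (Prod.ext rfl ?_)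
      have := hWB _ hq2
      simp only [ContinuousLinearMap.coe_fst']
      field_simp)
    (fun q hq => by
      have h := htgt q hq
      refine ContinuousAt.continuousWithinAt (ContinuousAt.mul (by fun_prop) ?_)
      exact ContinuousAt.comp (f := fun q : ℝ × ℝ => (q.2 + t₀, q.1)) (hW _ h).1.continuousAt
        (by fun_prop))
    (fun q hq h0 => by
      obtain ⟨hq1, hq2⟩ := hsrc q hq
      simp only [hg'a, sub_add_cancel, Prod.mk.eta, mul_eq_zero, hWB _ hq2, or_false] at h0
      exact hs q hq1 (eq_zero_of_pow_eq_zero h0))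
    hk.contDiffAt
  -- The straightening preserves the first coordinate, and B has constant sign on W; the speed
  -- therefore has the sign of B(t₀, 0) x^j.
  refine hbox.isVertical hj hB0 (fun q hq => ?_) hpe hep
  have hW' := (hW _ (htgt _ (hEt q hq))).2
  rw [hE1 q, sign_mul, sign_mul, mul_comm]
  congr 1
  rcases lt_or_gt_of_ne hB0 with h | h
  · rw [sign_neg h, sign_neg]
    rw [hE1] at hW'
    exact neg_of_mul_pos_right hW' h.le
  · rw [sign_pos h, sign_pos]
    rw [hE1] at hW'
    exact pos_of_mul_pos_right hW' h.le

/-- A curve of singular points along the direction of the flow. -/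
theorem isHorizontal_of_invariant (hp : p ∈ g.source) (hgp : g p = (t₀, 0)) (hj : j ≠ 0)
    (hd : ∀ q ∈ g.source,
      HasDerivAt (fun t => g (Φ t q)) ((g q).2 ^ j * A (g q), (g q).2 ^ j * B (g q)) 0)
    (hs : ∀ q ∈ g.source, (g q).2 = 0 → IsSingular Φ q)
    (hA : AnalyticAt ℝ A (t₀, 0)) (hB : AnalyticAt ℝ B (t₀, 0)) (hA0 : A (t₀, 0) ≠ 0)
    (hB0 : ∀ᶠ t in 𝓝 t₀, B (t, 0) = 0) :
    IsHorizontal Φ p := by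
  have hev : ∀ᶠ q in 𝓝 (t₀, (0 : ℝ)), AnalyticAt ℝ A q ∧ 0 < A (t₀, 0) * A q := by
    refine hA.eventually_analyticAt.and ?_
    exact continuousAt_const.eventually_lt (continuousAt_const.mul hA.continuousAt)
      (mul_self_pos.2 hA0)
  obtain ⟨W, hW, hWo, hpW⟩ := eventually_nhds_iff.1 hev
  have hWA : ∀ q ∈ W, A q ≠ 0 := fun q hq h => by simpa [h] using (hW q hq).2
  set L : ℝ × ℝ ≃ₜ ℝ × ℝ := shiftHomeomorph t₀ with hL
  have hLs : ∀ q, L.symm q = (q.1 + t₀, q.2) := fun q => rfl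
  set g' := (g.trans (OpenPartialHomeomorph.ofSet W hWo)).trans L.toOpenPartialHomeomorph with hg'
  have hsrc : ∀ q ∈ g'.source, q ∈ g.source ∧ g q ∈ W := fun q hq => by simpa [hg'] using hq
  have htgt : ∀ q ∈ g'.target, (q.1 + t₀, q.2) ∈ W := fun q hq => by
    have : L.symm q ∈ W := by
      simp [hg'] at hq
      exact hq.1
    exact this
  have hg'a : ∀ q, g' q = ((g q).1 - t₀, (g q).2) := fun q => rfl
  have hlin : AnalyticAt ℝ (fun q : ℝ × ℝ => (q.1 + t₀, q.2)) 0 :=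
    (analyticAt_fst.add analyticAt_const).prod analyticAt_snd
  have hkA : AnalyticAt ℝ (fun q : ℝ × ℝ => A (q.1 + t₀, q.2)) 0 :=
    AnalyticAt.fun_comp (by simpa using hA) hlin
  have hkB : AnalyticAt ℝ (fun q : ℝ × ℝ => B (q.1 + t₀, q.2)) 0 :=
    AnalyticAt.fun_comp (by simpa using hB) hlin
  have hk : AnalyticAt ℝ (fun q : ℝ × ℝ => B (q.1 + t₀, q.2) / A (q.1 + t₀, q.2)) 0 :=
    hkB.div hkA (by simpa using hA0)
  obtain ⟨E, e, hbox, hpe, hep, hEt, hE1, hE2⟩ := exists_flowBox (Φ := Φ) (g := g')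
    (lam := fun q => q.2 ^ j * A (q.1 + t₀, q.2)) (p := p) (by simp [hg', hp, hgp, hpW])
    (by rw [hg'a, hgp]; simp)
    (k := fun q : ℝ × ℝ => B (q.1 + t₀, q.2) / A (q.1 + t₀, q.2))
    (fun q hq => by
      obtain ⟨hq1, hq2⟩ := hsrc q hq
      have h := hd q hq1
      have h1 : HasDerivAt (fun t => (g (Φ t q)).1) _ 0 := hasFDerivAt_fst.comp_hasDerivAt _ h
      have h2 : HasDerivAt (fun t => (g (Φ t q)).2) _ 0 := hasFDerivAt_snd.comp_hasDerivAt _ h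
      have h3 := (h1.sub_const t₀).prodMk h2
      simp only [hg'a, sub_add_cancel, Prod.mk.eta]
      refine h3.congr_deriv (Prod.ext rfl ?_)
      have := hWA _ hq2
      simp only [ContinuousLinearMap.coe_snd']
      field_simp)
    (fun q hq => by
      have h := htgt q hq
      refine ContinuousAt.continuousWithinAt (ContinuousAt.mul (by fun_prop) ?_)
      exact ContinuousAt.comp (f := fun q : ℝ × ℝ => (q.1 + t₀, q.2)) (hW _ h).1.continuousAt
        (by fun_prop))
    (fun q hq h0 => by
      obtain ⟨hq1, hq2⟩ := hsrc q hq
      simp only [hg'a, sub_add_cancel, Prod.mk.eta, mul_eq_zero, hWA _ hq2, or_false] at h0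
      exact hs q hq1 (eq_zero_of_pow_eq_zero h0))
    hk.contDiffAt
  -- B = 0 on the axis makes the axis a curve of the direction field (1, B / A), so the
  -- straightening preserves the sign of the second coordinate.
  have hE2 := hE2 (by
    have hc : Tendsto (fun s : ℝ => s + t₀) (𝓝 0) (𝓝 t₀) := by
      simpa using (continuous_add_const t₀).tendsto 0
    exact (hc.eventually hB0).mono fun s h => by simp [h])
  refine hbox.isHorizontal hj hA0 (fun q hq => ?_) hpe hep
  have hW' := (hW _ (htgt _ (hEt q hq))).2
  rw [sign_mul, sign_mul, mul_comm, sign_pow, sign_pow, hE2 q hq]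
  congr 1
  rcases lt_or_gt_of_ne hA0 with h | h
  · rw [sign_neg h, sign_neg]
    exact neg_of_mul_pos_right hW' h.le
  · rw [sign_pos h, sign_pos]
    exact pos_of_mul_pos_right hW' h.le

end Essential

end SurfaceFlow

namespace SurfaceFlow

/-! ### Division of analytic maps by powers of the second variable. -/

section Hadamard

open Set Filter MeasureTheory
open scoped NNReal ENNReal

/-- The average of an analytic map over a family of linear contractions is analytic. -/
theorem analyticAt_integral_comp {E F : Type*} [NormedAddCommGroup E] [NormedSpace ℝ E]
    [NormedAddCommGroup F] [NormedSpace ℝ F] [CompleteSpace F] {G : E → F} (hG : AnalyticAt ℝ G 0)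
    {L : ℝ → E →L[ℝ] E} (hL : Continuous L) (hL1 : ∀ s ∈ Icc (0 : ℝ) 1, ‖L s‖ ≤ 1) :
    AnalyticAt ℝ (fun v => ∫ s in (0 : ℝ)..1, G (L s v)) 0 := by
  obtain ⟨p, r, hp⟩ := hG
  obtain ⟨r', hr'0, hr'r⟩ := ENNReal.lt_iff_exists_nnreal_btwn.1 hp.r_pos
  have hr'pos : (0 : ℝ≥0∞) < r' := hr'0
  have hr'p : (r' : ℝ≥0∞) < p.radius := hr'r.trans_le hp.r_le
  -- `Q n s` is the n-th term of the power series of G ∘ L s. Its norm is at most that of `p n`, so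
  -- integrating term by term in s loses nothing in the convergence.
  set Q : ∀ n, ℝ → E[×n]→L[ℝ] F := fun n s =>
    ContinuousMultilinearMap.compContinuousLinearMapContinuousMultilinear ℝ (fun _ : Fin n => E)
      (fun _ : Fin n => E) F (fun _ => L s) (p n) with hQ
  have hQa : ∀ n s v, Q n s (fun _ => v) = p n fun _ => L s v := fun n s v => rfl
  have hQc : ∀ n, Continuous (Q n) := fun n => by
    have h1 : Continuous fun s =>
        ContinuousMultilinearMap.compContinuousLinearMapContinuousMultilinear ℝ
          (fun _ : Fin n => E) (fun _ : Fin n => E) F (fun _ => L s) :=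
      (ContinuousMultilinearMap.cont _).comp (continuous_pi fun _ => hL)
    exact h1.clm_apply continuous_const
  have hIoc : ∀ s ∈ uIoc (0 : ℝ) 1, s ∈ Icc (0 : ℝ) 1 := fun s hs => by
    rw [uIoc_of_le zero_le_one] at hs
    exact Ioc_subset_Icc_self hs
  have hQn : ∀ n, ∀ s ∈ Icc (0 : ℝ) 1, ‖Q n s‖ ≤ ‖p n‖ := fun n s hs => by
    refine (ContinuousMultilinearMap.norm_compContinuousLinearMap_le (p n) fun _ => L s).trans ?_
    refine mul_le_of_le_one_right (norm_nonneg _) ?_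
    exact Finset.prod_le_one (fun _ _ => norm_nonneg _) fun _ _ => hL1 s hs
  set q : FormalMultilinearSeries ℝ E F := fun n => ∫ s in (0 : ℝ)..1, Q n s with hq
  have hqn : ∀ n, ‖q n‖ ≤ ‖p n‖ := fun n => by
    have := intervalIntegral.norm_integral_le_of_norm_le_const (a := (0 : ℝ)) (b := 1)
      (f := Q n) (C := ‖p n‖) fun s hs => hQn n s (hIoc s hs)
    simpa using this
  refine ⟨q, r', ⟨?_, hr'pos, fun {v} hv => ?_⟩⟩
  · obtain ⟨C, -, hC⟩ := p.norm_mul_pow_le_of_lt_radius hr'p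
    exact q.le_radius_of_bound C fun n =>
      (mul_le_mul_of_nonneg_right (hqn n) (by positivity)).trans (hC n)
  · have hvlt : (‖v‖₊ : ℝ≥0∞) < r' := by
      rw [Metric.mem_eball, edist_zero_right] at hv
      exact hv
    have hvr : (‖v‖₊ : ℝ≥0∞) < p.radius := hvlt.trans hr'p
    have hqa : ∀ n, q n (fun _ => v) = ∫ s in (0 : ℝ)..1, p n fun _ => L s v := fun n => by
      have := (ContinuousMultilinearMap.apply ℝ (fun _ : Fin n => E) F
        (fun _ => v)).intervalIntegral_comp_comm ((hQc n).intervalIntegrable (μ := volume) 0 1)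
      exact this.symm
    simp only [zero_add, hqa]
    refine intervalIntegral.hasSum_integral_of_dominated_convergence
      (fun n _ => ‖p n‖ * (‖v‖₊ : ℝ) ^ n) (fun n => ?_) (fun n => ?_) ?_ ?_ ?_
    · have : Continuous fun s => p n fun _ => L s v :=
        (p n).cont.comp (continuous_pi fun _ => hL.clm_apply continuous_const)
      exact this.aestronglyMeasurable
    · refine ae_of_all _ fun s hs => ?_
      have h1 := (Q n s).le_opNorm fun _ => v
      rw [hQa] at h1
      refine h1.trans ?_
      simp only [Finset.prod_const, Finset.card_univ, Fintype.card_fin, coe_nnnorm]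
      exact mul_le_mul_of_nonneg_right (hQn n s (hIoc s hs)) (by positivity)
    · exact ae_of_all _ fun _ _ => p.summable_norm_mul_pow hvr
    · exact intervalIntegrable_const
    · refine ae_of_all _ fun s hs => ?_
      have hmem : L s v ∈ Metric.eball (0 : E) r := by
        have h1 : ‖L s v‖₊ ≤ ‖v‖₊ := by
          have := (L s).le_opNorm v
          have h2 : ‖L s‖ * ‖v‖ ≤ 1 * ‖v‖ :=
            mul_le_mul_of_nonneg_right (hL1 s (hIoc s hs)) (norm_nonneg _)
          rw [one_mul] at h2
          exact this.trans h2
        have h4 : (‖L s v‖₊ : ℝ≥0∞) < r := (ENNReal.coe_le_coe.2 h1).trans_lt (hvlt.trans hr'r)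
        rw [Metric.mem_eball, edist_zero_right]; exact h4
      simpa using hp.hasSum hmem

variable {F : Type*} [NormedAddCommGroup F] [NormedSpace ℝ F]

/-- The partial derivative with respect to the second variable. -/
noncomputable def derivSnd (G : ℝ × ℝ → F) (p : ℝ × ℝ) : F := fderiv ℝ G p (0, 1)

theorem hasDerivAt_derivSnd {G : ℝ × ℝ → F} {x y : ℝ} (hG : DifferentiableAt ℝ G (x, y)) :
    HasDerivAt (fun s => G (x, s)) (derivSnd G (x, y)) y := by
  have h1 : HasDerivAt (fun s : ℝ => (x, s)) (0, 1) y :=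
    (hasDerivAt_const y x).prodMk (hasDerivAt_id y)
  exact hG.hasFDerivAt.comp_hasDerivAt y h1

variable [CompleteSpace F]

theorem analyticAt_derivSnd {G : ℝ × ℝ → F} {p : ℝ × ℝ} (hG : AnalyticAt ℝ G p) :
    AnalyticAt ℝ (derivSnd G) p :=
  ((ContinuousLinearMap.apply ℝ F ((0, 1) : ℝ × ℝ)).analyticAt _).comp hG.fderiv

/-- Hadamard's lemma for analytic maps: division by the second variable. -/
theorem exists_eq_add_snd_smul {G : ℝ × ℝ → F} (hG : AnalyticAt ℝ G 0) :
    ∃ H : ℝ × ℝ → F, AnalyticAt ℝ H 0 ∧ ∀ᶠ p in 𝓝 0, G p = G (p.1, 0) + p.2 • H p := by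
  -- The quotient is H(x, y) = ∫₀¹ ∂G/∂y (x, s y) ds, an average over the contractions (x, y) ↦ (x,
  -- s y).
  set L : ℝ → ℝ × ℝ →L[ℝ] ℝ × ℝ := fun s =>
    (ContinuousLinearMap.fst ℝ ℝ ℝ).prod (s • ContinuousLinearMap.snd ℝ ℝ ℝ) with hL
  have hLa : ∀ s v, L s v = (v.1, s * v.2) := fun s v => rfl
  have hLc : Continuous L := by
    have h1 : Continuous fun s : ℝ => (ContinuousLinearMap.inr ℝ ℝ ℝ).comp
        (s • ContinuousLinearMap.snd ℝ ℝ ℝ) := by fun_prop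
    have h2 : L = fun s => (ContinuousLinearMap.inl ℝ ℝ ℝ).comp (ContinuousLinearMap.fst ℝ ℝ ℝ) +
        (ContinuousLinearMap.inr ℝ ℝ ℝ).comp (s • ContinuousLinearMap.snd ℝ ℝ ℝ) := by
      funext s
      ext <;> simp [hL]
    rw [h2]
    exact continuous_const.add h1
  have hL1 : ∀ s ∈ Icc (0 : ℝ) 1, ‖L s‖ ≤ 1 := fun s hs => by
    refine ContinuousLinearMap.opNorm_le_bound _ zero_le_one fun v => ?_
    rw [hLa, one_mul, Prod.norm_def, Prod.norm_def]
    refine max_le_max le_rfl ?_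
    simp only [norm_mul, Real.norm_eq_abs, abs_of_nonneg hs.1]
    exact mul_le_of_le_one_left (abs_nonneg _) hs.2
  refine ⟨_, analyticAt_integral_comp (analyticAt_derivSnd hG) hLc hL1, ?_⟩
  obtain ⟨ε, hε, hball⟩ := Metric.eventually_nhds_iff_ball.1 hG.eventually_analyticAt
  filter_upwards [Metric.ball_mem_nhds _ hε] with p hp
  have hmem : ∀ s ∈ Icc (0 : ℝ) 1, (p.1, s * p.2) ∈ Metric.ball (0 : ℝ × ℝ) ε := fun s hs => by
    rw [mem_ball_zero_iff] at hp ⊢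
    have := (L s).le_opNorm p
    have h2 : ‖L s‖ * ‖p‖ ≤ 1 * ‖p‖ := mul_le_mul_of_nonneg_right (hL1 s hs) (norm_nonneg _)
    rw [hLa] at this
    linarith
  have hder : ∀ s ∈ uIcc (0 : ℝ) 1,
      HasDerivAt (fun s => G (p.1, s * p.2)) (p.2 • derivSnd G (p.1, s * p.2)) s := fun s hs => by
    rw [uIcc_of_le zero_le_one] at hs
    have h1 := hasDerivAt_derivSnd (hball _ (hmem s hs)).differentiableAt
    have h2 : HasDerivAt (fun s : ℝ => s * p.2) p.2 s := by
      simpa using (hasDerivAt_id s).mul_const p.2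
    exact HasDerivAt.scomp (h := fun s : ℝ => s * p.2) s h1 h2
  have hcont : ContinuousOn (fun s => p.2 • derivSnd G (p.1, s * p.2)) (uIcc (0 : ℝ) 1) := by
    rw [uIcc_of_le zero_le_one]
    refine continuousOn_const.smul fun s hs => ContinuousAt.continuousWithinAt ?_
    exact ContinuousAt.comp (f := fun s : ℝ => (p.1, s * p.2))
      (analyticAt_derivSnd (hball _ (hmem s hs))).continuousAt (by fun_prop)
  have := intervalIntegral.integral_eq_sub_of_hasDerivAt hder hcont.intervalIntegrable
  simp only [one_mul, zero_mul, Prod.mk.eta, intervalIntegral.integral_smul] at this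
  simp only [hLa, this]
  abel

/-- An analytic map not vanishing on the vertical axis is the product of a power of the second
variable and of a map not vanishing on the horizontal axis. -/
theorem exists_eq_snd_pow_smul {G : ℝ × ℝ → F} (hG : AnalyticAt ℝ G 0)
    (h : ¬ ∀ᶠ y in 𝓝 (0 : ℝ), G (0, y) = 0) :
    ∃ (j : ℕ) (H : ℝ × ℝ → F), AnalyticAt ℝ H 0 ∧ (∀ᶠ p in 𝓝 0, G p = p.2 ^ j • H p) ∧
      ¬ ∀ᶠ t in 𝓝 (0 : ℝ), H (t, 0) = 0 := by
  have hline : ∀ {H : ℝ × ℝ → F}, AnalyticAt ℝ H 0 → AnalyticAt ℝ (fun y => H (0, y)) 0 :=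
    fun hH => AnalyticAt.fun_comp (x := (0 : ℝ)) (f := fun y : ℝ => ((0 : ℝ), y)) hH
      (analyticAt_const.prod analyticAt_id)
  have htend : Tendsto (fun y : ℝ => ((0 : ℝ), y)) (𝓝 0) (𝓝 0) :=
    (by fun_prop : Continuous fun y : ℝ => ((0 : ℝ), y)).tendsto 0
  have hord : analyticOrderAt (fun y => G (0, y)) 0 ≠ ⊤ := fun h' => h (analyticOrderAt_eq_top.1 h')
  obtain ⟨n, hn⟩ := ENat.ne_top_iff_exists.1 hord
  clear hord h
  induction n generalizing G with
  | zero =>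
    refine ⟨0, G, hG, by simp, fun h0 => ?_⟩
    have := (hline hG).analyticOrderAt_eq_zero.1 hn.symm
    exact this h0.self_of_nhds
  | succ n ih =>
    -- Each division by y lowers the order of y ↦ G(0, y) by one, so the divisions come to an end.
    by_cases h0 : ∀ᶠ t in 𝓝 (0 : ℝ), G (t, 0) = 0
    · obtain ⟨H, hH, hGH⟩ := exists_eq_add_snd_smul hG
      have hGH' : ∀ᶠ p in 𝓝 0, G p = p.2 • H p := by
        filter_upwards [hGH, (continuousAt_fst (p := (0 : ℝ × ℝ))).eventually h0] with p h1 h2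
        rw [h1, h2, zero_add]
      have hord : analyticOrderAt (fun y => H (0, y)) 0 = n := by
        have h1 : (fun y => G (0, y)) =ᶠ[𝓝 0] (id : ℝ → ℝ) • fun y => H (0, y) :=
          (htend.eventually hGH').mono fun y hy => hy
        rw [analyticOrderAt_congr h1, analyticOrderAt_smul analyticAt_id (hline hH),
          analyticOrderAt_id, add_comm] at hn
        push_cast at hn
        exact (WithTop.add_left_cancel WithTop.one_ne_top hn).symm
      obtain ⟨j, K, hK, hHK, hne⟩ := ih hH hord.symm
      refine ⟨j + 1, K, hK, ?_, hne⟩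
      filter_upwards [hGH', hHK] with p h1 h2
      rw [h1, h2, smul_smul, pow_succ']
    · exact ⟨0, G, hG, by simp, h0⟩

end Hadamard

end SurfaceFlow

namespace SurfaceFlow

/-! ### Non-essential points along an analytic arc. -/

section Arc

open Set Filter

/-- The coordinates `(t, Y)` of the right half-plane given by `x = t ^ m`, `y = φ t + Y`. -/
noncomputable def arcChart (m : ℕ) (hm : m ≠ 0) (φ : ℝ → ℝ) (ε : ℝ) (hφ : ContinuousOn φ (Ioo 0 ε)) :
    OpenPartialHomeomorph (ℝ × ℝ) (ℝ × ℝ) where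
  toFun p := (p.1 ^ (m : ℝ)⁻¹, p.2 - φ (p.1 ^ (m : ℝ)⁻¹))
  invFun p := (p.1 ^ m, φ p.1 + p.2)
  source := {p | 0 < p.1 ∧ p.1 ^ (m : ℝ)⁻¹ < ε}
  target := Ioo 0 ε ×ˢ univ
  map_source' p hp := ⟨⟨Real.rpow_pos_of_pos hp.1 _, hp.2⟩, mem_univ _⟩
  map_target' p hp := ⟨pow_pos hp.1.1 m, by
    change (p.1 ^ m) ^ (m : ℝ)⁻¹ < ε
    rw [Real.pow_rpow_inv_natCast hp.1.1.le hm]; exact hp.1.2⟩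
  left_inv' p hp := by
    ext
    · exact Real.rpow_inv_natCast_pow hp.1.le hm
    · simp
  right_inv' p hp := by
    ext
    · exact Real.pow_rpow_inv_natCast hp.1.1.le hm
    · simp [Real.pow_rpow_inv_natCast hp.1.1.le hm]
  open_source := by
    have hc : Continuous fun p : ℝ × ℝ => p.1 ^ (m : ℝ)⁻¹ :=
      (Real.continuous_rpow_const (by positivity)).comp continuous_fst
    exact (isOpen_lt continuous_const continuous_fst).inter (isOpen_lt hc continuous_const)
  open_target := isOpen_Ioo.prod isOpen_univ
  continuousOn_toFun := by
    have hc : Continuous fun p : ℝ × ℝ => p.1 ^ (m : ℝ)⁻¹ :=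
      (Real.continuous_rpow_const (by positivity)).comp continuous_fst
    refine hc.continuousOn.prodMk (continuousOn_snd.sub (hφ.comp hc.continuousOn fun p hp => ?_))
    exact ⟨Real.rpow_pos_of_pos hp.1 _, hp.2⟩
  continuousOn_invFun := by
    refine ContinuousOn.prodMk (by fun_prop) (ContinuousOn.add ?_ continuousOn_snd)
    exact hφ.comp continuousOn_fst fun p hp => hp.1

theorem hasDerivAt_rpow_inv_natCast {m : ℕ} (hm : m ≠ 0) {x : ℝ} (hx : 0 < x) :
    HasDerivAt (fun x : ℝ => x ^ (m : ℝ)⁻¹) (m * (x ^ (m : ℝ)⁻¹) ^ (m - 1))⁻¹ x := by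
  refine HasDerivAt.of_local_left_inverse (f := fun t => t ^ m) ?_ (hasDerivAt_pow m _) ?_ ?_
  · exact Real.continuousAt_rpow_const _ _ (Or.inl hx.ne')
  · have := Real.rpow_pos_of_pos hx (m : ℝ)⁻¹
    positivity
  · exact (lt_mem_nhds hx).mono fun y hy => Real.rpow_inv_natCast_pow (le_of_lt hy) hm

variable {X : Type*} [TopologicalSpace X]

/-- A chart in which the flow is generated by the analytic vector field `V`. -/
structure AnalyticChart (Φ : Flow ℝ X) (e : OpenPartialHomeomorph X (ℝ × ℝ))
    (V : ℝ × ℝ → ℝ × ℝ) : Prop where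
  analytic : AnalyticOnNhd ℝ V e.target
  deriv_zero : ∀ q ∈ e.source, HasDerivAt (fun t => e (Φ t q)) (V (e q)) 0
  sing : ∀ q ∈ e.source, V (e q) = 0 → IsSingular Φ q

variable {Φ : Flow ℝ X} {e : OpenPartialHomeomorph X (ℝ × ℝ)} {V : ℝ × ℝ → ℝ × ℝ}

theorem AnalyticChart.isSingular_iff (hc : AnalyticChart Φ e V) {q : X} (hq : q ∈ e.source) :
    IsSingular Φ q ↔ V (e q) = 0 := by
  refine ⟨fun h => ?_, hc.sing q hq⟩
  have h1 := hc.deriv_zero q hq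
  have h2 : (fun t => e (Φ t q)) = fun _ => e q := funext fun t => by rw [h t]
  rw [h2] at h1
  exact h1.unique (hasDerivAt_const _ _)

/-- The points of an analytic arc transverse to the vertical axis are eventually not essential. -/
theorem AnalyticChart.eventually_arc_notMem (hc : AnalyticChart Φ e V) (h0 : (0 : ℝ × ℝ) ∈ e.target)
    (hV : ¬ ∀ᶠ y in 𝓝 (0 : ℝ), V (0, y) = 0) {m : ℕ} (hm : m ≠ 0) {φ : ℝ → ℝ}
    (hφ : AnalyticAt ℝ φ 0) (hφ0 : φ 0 = 0) :
    ∀ᶠ t in 𝓝[>] (0 : ℝ), e.symm (t ^ m, φ t) ∉ essentialSingularSet Φ := by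
  set G : ℝ × ℝ → ℝ × ℝ := fun p => V (p.1 ^ m, φ p.1 + p.2) with hGdef
  have hG : AnalyticAt ℝ G 0 := by
    refine AnalyticAt.fun_comp (x := (0 : ℝ × ℝ)) (f := fun p : ℝ × ℝ => (p.1 ^ m, φ p.1 + p.2)) ?_ ?_
    · have : ((0 : ℝ) ^ m, φ (0 : ℝ) + 0) = (0 : ℝ × ℝ) := by
        rw [zero_pow hm, hφ0, add_zero]; rfl
      have h := hc.analytic 0 h0
      rw [← this] at h
      exact h
    · exact (analyticAt_fst.pow m).prod
        ((AnalyticAt.fun_comp (x := (0 : ℝ × ℝ)) (f := Prod.fst) hφ analyticAt_fst).add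
          analyticAt_snd)
  have hG0 : ¬ ∀ᶠ y in 𝓝 (0 : ℝ), G (0, y) = 0 := by
    simpa [hGdef, zero_pow hm, hφ0] using hV
  obtain ⟨j, H, hH, hGH, hHne⟩ := exists_eq_snd_pow_smul hG hG0
  -- With w = m t^(m-1), the flow satisfies t' = x' / w and Y' = y' - φ'(t) t', hence Y' = Y^j Q /
  -- w: up to the factor w, Q is the component of H transverse to the arc.
  set Q : ℝ × ℝ → ℝ := fun p => (m * p.1 ^ (m - 1)) * (H p).2 - deriv φ p.1 * (H p).1 with hQdef
  have hH1 : ∀ {p}, AnalyticAt ℝ H p → AnalyticAt ℝ (fun p => (H p).1) p := fun h =>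
    analyticAt_fst.fun_comp h
  have hH2 : ∀ {p}, AnalyticAt ℝ H p → AnalyticAt ℝ (fun p => (H p).2) p := fun h =>
    analyticAt_snd.fun_comp h
  have hQ : ∀ {p}, AnalyticAt ℝ H p → AnalyticAt ℝ φ p.1 → AnalyticAt ℝ Q p := fun {p} h hφ =>
    ((analyticAt_const.mul (analyticAt_fst.pow _)).mul (hH2 h)).sub
      ((AnalyticAt.fun_comp (f := Prod.fst) hφ.deriv analyticAt_fst).mul (hH1 h))
  have hline : ContinuousAt (fun t : ℝ => (t, (0 : ℝ))) 0 := by fun_prop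
  have hlineA : AnalyticAt ℝ (fun t : ℝ => (t, (0 : ℝ))) 0 := analyticAt_id.prod analyticAt_const
  have ev1 : ∀ᶠ t in 𝓝 (0 : ℝ), ∀ᶠ p in 𝓝 (t, (0 : ℝ)), G p = p.2 ^ j • H p :=
    hline.eventually (eventually_eventually_nhds.2 hGH)
  have ev2 : ∀ᶠ t in 𝓝 (0 : ℝ), AnalyticAt ℝ H (t, 0) := hline.eventually hH.eventually_analyticAt
  obtain ⟨ε, hε, hφε⟩ := Metric.eventually_nhds_iff_ball.1 hφ.eventually_analyticAt
  have ev4 : ∀ᶠ t in 𝓝 (0 : ℝ), (t ^ m, φ t) ∈ e.target := by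
    have : ContinuousAt (fun t : ℝ => (t ^ m, φ t)) 0 := (by fun_prop : ContinuousAt _ _).prodMk
      hφ.continuousAt
    refine this.eventually_mem (e.open_target.mem_nhds ?_)
    rw [zero_pow hm, hφ0]; exact h0
  have ev5 : ∀ᶠ t in 𝓝[>] (0 : ℝ), H (t, 0) ≠ 0 := by
    have h1 : AnalyticAt ℝ (fun t => H (t, 0)) 0 := AnalyticAt.fun_comp (x := (0 : ℝ)) hH hlineA
    have h2 := h1.eventually_eq_zero_or_eventually_ne_zero.resolve_left hHne
    exact h2.filter_mono (nhdsWithin_mono _ fun t ht => ne_of_gt ht)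
  -- The dichotomy between vertical and horizontal: an analytic function of t vanishes identically
  -- near 0 or has no zero for small t > 0.
  have ev6 : (∀ᶠ t in 𝓝[>] (0 : ℝ), Q (t, 0) ≠ 0) ∨
      ∀ᶠ t in 𝓝[>] (0 : ℝ), ∀ᶠ s in 𝓝 t, Q (s, 0) = 0 := by
    have h1 : AnalyticAt ℝ (fun t => Q (t, 0)) 0 :=
      AnalyticAt.fun_comp (x := (0 : ℝ)) (hQ hH hφ) hlineA
    rcases h1.eventually_eq_zero_or_eventually_ne_zero with h | h
    · exact Or.inr ((eventually_eventually_nhds.2 h).filter_mono nhdsWithin_le_nhds)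
    · exact Or.inl (h.filter_mono (nhdsWithin_mono _ fun t ht => ne_of_gt ht))
  have ev7 : ∀ᶠ t in 𝓝[>] (0 : ℝ), Q (t, 0) ≠ 0 ∨ ∀ᶠ s in 𝓝 t, Q (s, 0) = 0 :=
    ev6.elim (fun h => h.mono fun _ => Or.inl) fun h => h.mono fun _ => Or.inr
  filter_upwards [ev1.filter_mono nhdsWithin_le_nhds, ev2.filter_mono nhdsWithin_le_nhds,
    ev4.filter_mono nhdsWithin_le_nhds, ev5, ev7, Ioo_mem_nhdsGT hε] with t₀ h1 h2 h4 h5 h7 ht₀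
  rintro ⟨hsing, hnv, hnh⟩
  set p := e.symm (t₀ ^ m, φ t₀) with hp
  have hps : p ∈ e.source := e.map_target h4
  have hep : e p = (t₀ ^ m, φ t₀) := e.right_inv h4
  have hGp : ∀ r : ℝ × ℝ, G r = V (r.1 ^ m, φ r.1 + r.2) := fun r => rfl
  -- With j = 0 the field would equal H(t₀, 0) ≠ 0 at a singular point.
  have hj : j ≠ 0 := by
    rintro rfl
    have h := (hc.isSingular_iff hps).1 hsing
    have h' := h1.self_of_nhds
    rw [hGp, pow_zero, one_smul, add_zero, ← hep, h] at h'
    exact h5 h'.symm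
  have hφε' : ∀ t ∈ Ioo 0 ε, AnalyticAt ℝ φ t := fun t ht => hφε t (by
    rw [Real.ball_eq_Ioo]; exact ⟨by linarith [ht.1], by linarith [ht.2]⟩)
  set C := arcChart m hm φ ε fun t ht => (hφε' t ht).continuousAt.continuousWithinAt with hC
  have hCa : ∀ q, C q = (q.1 ^ (m : ℝ)⁻¹, q.2 - φ (q.1 ^ (m : ℝ)⁻¹)) := fun q => rfl
  have hCs : ∀ q, C.symm q = (q.1 ^ m, φ q.1 + q.2) := fun q => rfl
  have hct : (t₀, (0 : ℝ)) ∈ C.target := ⟨ht₀, mem_univ _⟩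
  obtain ⟨W, hW, hWo, hpW⟩ := eventually_nhds_iff.1 h1
  set g := (e.trans C).trans (OpenPartialHomeomorph.ofSet W hWo) with hg
  have hga : ∀ q, g q = C (e q) := fun q => rfl
  have hep' : e p = C.symm (t₀, 0) := by rw [hep, hCs, add_zero]
  have hgp : g p = (t₀, 0) := by rw [hga, hep', C.right_inv hct]
  have hsrc : ∀ q ∈ g.source, q ∈ e.source ∧ e q ∈ C.source ∧ C (e q) ∈ W := fun q hq => by
    simpa [hg, and_assoc] using hq
  have hpg : p ∈ g.source := by
    have : e p ∈ C.source := hep' ▸ C.map_target hct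
    have h' : C (e p) ∈ W := by rw [← hga, hgp]; exact hpW
    simp [hg, hps, this, h']
  have hVg : ∀ q ∈ g.source, V (e q) = (g q).2 ^ j • H (g q) := fun q hq => by
    obtain ⟨_, hqC, hqW⟩ := hsrc q hq
    rw [hga, ← hW _ hqW, hGp]
    congr 1
    exact (C.left_inv hqC).symm
  have hd : ∀ q ∈ g.source, HasDerivAt (fun t => g (Φ t q))
      ((g q).2 ^ j * ((H (g q)).1 / (m * (g q).1 ^ (m - 1))),
        (g q).2 ^ j * (Q (g q) / (m * (g q).1 ^ (m - 1)))) 0 := fun q hq => by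
    obtain ⟨hqe, hqC, hqW⟩ := hsrc q hq
    have hd := hc.deriv_zero q hqe
    have hΦ : Φ 0 q = q := Flow.map_zero_apply Φ q
    have hpos : 0 < (e q).1 := hqC.1
    have htpos : 0 < (g q).1 := (C.map_source hqC).1.1
    have hx : HasDerivAt (fun t => (e (Φ t q)).1) (V (e q)).1 0 :=
      (hasFDerivAt_fst.comp_hasDerivAt _ hd :)
    have hy : HasDerivAt (fun t => (e (Φ t q)).2) (V (e q)).2 0 :=
      (hasFDerivAt_snd.comp_hasDerivAt _ hd :)
    have ht : HasDerivAt (fun t => (e (Φ t q)).1 ^ (m : ℝ)⁻¹)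
        ((m * (g q).1 ^ (m - 1))⁻¹ * (V (e q)).1) 0 := by
      refine HasDerivAt.comp (h := fun t => (e (Φ t q)).1) (h₂ := fun x => x ^ (m : ℝ)⁻¹) 0 ?_ hx
      rw [hΦ]
      exact hasDerivAt_rpow_inv_natCast hm hpos
    have hφd : HasDerivAt (fun t => φ ((e (Φ t q)).1 ^ (m : ℝ)⁻¹))
        (deriv φ (g q).1 * ((m * (g q).1 ^ (m - 1))⁻¹ * (V (e q)).1)) 0 := by
      refine HasDerivAt.comp (h := fun t => (e (Φ t q)).1 ^ (m : ℝ)⁻¹) (h₂ := φ) 0 ?_ ht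
      rw [hΦ]
      exact (hφε' _ (C.map_source hqC).1).differentiableAt.hasDerivAt
    refine (ht.prodMk (hy.sub hφd)).congr_deriv ?_
    have hw : (m : ℝ) * (g q).1 ^ (m - 1) ≠ 0 := by positivity
    rw [hVg q hq]
    ext
    · simp only [Prod.smul_fst, smul_eq_mul]
      field_simp
    · simp only [Prod.smul_fst, Prod.smul_snd, smul_eq_mul, hQdef]
      field_simp
  have hs : ∀ q ∈ g.source, (g q).2 = 0 → IsSingular Φ q := fun q hq h => by
    refine hc.sing q (hsrc q hq).1 ?_
    rw [hVg q hq, h, zero_pow hj, zero_smul]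
  have hwA : AnalyticAt ℝ (fun q : ℝ × ℝ => (m : ℝ) * q.1 ^ (m - 1)) (t₀, 0) :=
    analyticAt_const.mul (analyticAt_fst.pow _)
  have ht₀' := ht₀.1
  have hw0 : (m : ℝ) * t₀ ^ (m - 1) ≠ 0 := by positivity
  have hA := (hH1 h2).div hwA hw0
  have hB := (hQ h2 (hφε' t₀ ht₀)).div hwA hw0
  rcases h7 with h7 | h7
  · exact hnv (isVertical_of_transverse hpg hgp hj hd hs hA hB (div_ne_zero h7 hw0))
  · have hQ0 := h7.self_of_nhds
    -- If Q and the first component of H both vanished here, so would the second, since w ≠ 0; but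
    -- H(t₀, 0) ≠ 0.
    have hP : (H (t₀, 0)).1 ≠ 0 := fun h => by
      simp only [hQdef, h, mul_zero, sub_zero] at hQ0
      exact h5 (Prod.ext h ((mul_eq_zero.1 hQ0).resolve_left hw0))
    exact hnh (isHorizontal_of_invariant hpg hgp hj hd hs hA hB (div_ne_zero hP hw0)
      (h7.mono fun s hs => by simp [hs]))

end Arc

end SurfaceFlow

namespace SurfaceFlow

/-! ### Normal form of a function of finite order in y, without term of degree n - 1. -/

section Preparation

open Set Filter

/-- The analytic implicit function theorem for a planar scalar equation. -/
theorem exists_analytic_implicit {F : ℝ × ℝ → ℝ} (hF : AnalyticAt ℝ F 0) (h0 : F 0 = 0)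
    (h1 : derivSnd F 0 ≠ 0) :
    ∃ c : ℝ → ℝ, AnalyticAt ℝ c 0 ∧ c 0 = 0 ∧ ∀ᶠ x in 𝓝 (0 : ℝ), F (x, c x) = 0 := by
  have hc : ContDiffAt ℝ ω F (0 : ℝ × ℝ) := hF.contDiffAt
  have hinv : (fderiv ℝ F (0 : ℝ × ℝ) ∘L .inr ℝ ℝ ℝ).IsInvertible := by
    refine ⟨ContinuousLinearEquiv.unitsEquivAut ℝ (Units.mk0 _ h1), ?_⟩
    ext
    simp [derivSnd]
  refine ⟨hc.implicitFunction (by simp) hinv, ?_, ?_, ?_⟩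
  · exact (hc.contDiffAt_implicitFunction (by simp) hinv).analyticAt
  · exact hc.implicitFunction_apply_self (by simp) hinv
  · exact (hc.eventually_apply_implicitFunction (by simp) hinv).mono fun x hx => hx.trans h0

theorem exists_taylor_snd {G : ℝ × ℝ → ℝ} (hG : AnalyticAt ℝ G 0) (n : ℕ) :
    ∃ (a : ℕ → ℝ → ℝ) (u : ℝ × ℝ → ℝ), (∀ i, AnalyticAt ℝ (a i) 0) ∧ AnalyticAt ℝ u 0 ∧
      ∀ᶠ p in 𝓝 0, G p = ∑ i ∈ Finset.range n, p.2 ^ i * a i p.1 + p.2 ^ n * u p := by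
  induction n with
  | zero => exact ⟨fun _ _ => 0, G, fun _ => analyticAt_const, hG, by simp⟩
  | succ n ih =>
    obtain ⟨a, u, ha, hu, h⟩ := ih
    obtain ⟨v, hv, huv⟩ := exists_eq_add_snd_smul hu
    have hu0 : AnalyticAt ℝ (fun x => u (x, 0)) 0 :=
      AnalyticAt.fun_comp (x := (0 : ℝ)) (f := fun x : ℝ => (x, (0 : ℝ))) hu
        (analyticAt_id.prod analyticAt_const)
    refine ⟨Function.update a n fun x => u (x, 0), v, fun i => ?_, hv, ?_⟩
    · rcases eq_or_ne i n with rfl | hi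
      · simpa using hu0
      · simpa [hi] using ha i
    · filter_upwards [h, huv] with p h1 h2
      rw [h1, Finset.sum_range_succ, h2, smul_eq_mul]
      have : ∑ i ∈ Finset.range n, p.2 ^ i * Function.update a n (fun x => u (x, 0)) i p.1 =
          ∑ i ∈ Finset.range n, p.2 ^ i * a i p.1 :=
        Finset.sum_congr rfl fun i hi => by
          rw [Function.update_of_ne (Finset.mem_range.1 hi).ne]
      rw [this, Function.update_self]
      ring

theorem derivSnd_congr {G H : ℝ × ℝ → ℝ} {p : ℝ × ℝ} (h : G =ᶠ[𝓝 p] H) :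
    derivSnd G =ᶠ[𝓝 p] derivSnd H :=
  (h.fderiv (𝕜 := ℝ)).mono fun q hq => by simp only [derivSnd, hq]

theorem derivSnd_eq_of_hasDerivAt {G : ℝ × ℝ → ℝ} {p : ℝ × ℝ} {d : ℝ} (hG : AnalyticAt ℝ G p)
    (h : HasDerivAt (fun s => G (p.1, s)) d p.2) : derivSnd G p = d :=
  (hasDerivAt_derivSnd (x := p.1) (y := p.2) hG.differentiableAt).unique h

theorem analyticAt_iterate_derivSnd {G : ℝ × ℝ → ℝ} {p : ℝ × ℝ} (hG : AnalyticAt ℝ G p) (n : ℕ) :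
    AnalyticAt ℝ (derivSnd^[n] G) p := by
  induction n with
  | zero => exact hG
  | succ n ih => rw [Function.iterate_succ']; exact analyticAt_derivSnd ih

/-- The `n`-th partial derivative on the axis is the `n`-th coefficient of the Taylor expansion. -/
theorem iterate_derivSnd_eq {n : ℕ} {G u : ℝ × ℝ → ℝ} {a : ℕ → ℝ → ℝ}
    (ha : ∀ i, AnalyticAt ℝ (a i) 0) (hu : AnalyticAt ℝ u 0) (hG : AnalyticAt ℝ G 0)
    (h : ∀ᶠ p in 𝓝 0, G p = ∑ i ∈ Finset.range n, p.2 ^ i * a i p.1 + p.2 ^ n * u p) :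
    ∀ᶠ x in 𝓝 (0 : ℝ), (derivSnd^[n] G) (x, 0) = n.factorial * u (x, 0) := by
  have hline : Tendsto (fun x : ℝ => (x, (0 : ℝ))) (𝓝 0) (𝓝 0) :=
    (by fun_prop : Continuous fun x : ℝ => (x, (0 : ℝ))).tendsto 0
  induction n generalizing G u a with
  | zero => exact (hline.eventually h).mono fun x hx => by simpa using hx
  | succ n ih =>
    -- The y-derivative of y^(n+1) u is y^n ((n+1) u + y ∂u/∂y), a remainder of the same shape with
    -- one degree less.
    have hu' : AnalyticAt ℝ (fun p : ℝ × ℝ => (n + 1 : ℝ) * u p + p.2 * derivSnd u p) 0 :=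
      (analyticAt_const.mul hu).add (analyticAt_snd.mul (analyticAt_derivSnd hu))
    have key := ih (G := derivSnd G) (u := fun p => (n + 1 : ℝ) * u p + p.2 * derivSnd u p)
      (a := fun i x => (i + 1 : ℝ) * a (i + 1) x)
      (fun i => analyticAt_const.mul (ha (i + 1))) hu' (analyticAt_derivSnd hG) (by
        filter_upwards [eventually_eventually_nhds.2 h, hG.eventually_analyticAt,
          hu.eventually_analyticAt] with p hp hGp hup
        refine derivSnd_eq_of_hasDerivAt hGp ?_
        have hpl : Tendsto (fun s => (p.1, s)) (𝓝 p.2) (𝓝 p) :=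
          (by fun_prop : Continuous fun s => (p.1, s)).tendsto p.2
        refine HasDerivAt.congr_of_eventuallyEq ?_ (hpl.eventually hp)
        simp only
        have h1 : HasDerivAt (fun s => ∑ i ∈ Finset.range (n + 1), s ^ i * a i p.1)
            (∑ i ∈ Finset.range (n + 1), (i * p.2 ^ (i - 1)) * a i p.1) p.2 :=
          HasDerivAt.fun_sum fun i _ => (hasDerivAt_pow i p.2).mul_const _
        have h2 := (hasDerivAt_pow (n + 1) p.2).mul
          (hasDerivAt_derivSnd (x := p.1) (y := p.2) hup.differentiableAt)
        refine (h1.add h2).congr_deriv ?_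
        rw [Finset.sum_range_succ']
        simp only [Prod.mk.eta, Nat.cast_add, Nat.cast_one, Nat.cast_zero, zero_mul, add_zero,
          Nat.add_sub_cancel]
        rw [mul_add]
        congr 1
        · exact Finset.sum_congr rfl fun i _ => by ring
        · ring)
    refine key.mono fun x hx => ?_
    rw [Function.iterate_succ_apply, hx, Nat.factorial_succ]
    push_cast
    ring

theorem iterate_derivSnd_line {F : ℝ × ℝ → ℝ} (hF : AnalyticAt ℝ F 0) (k : ℕ) :
    (fun y => (derivSnd^[k] F) (0, y)) =ᶠ[𝓝 0] deriv^[k] fun y => F (0, y) := by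
  have hline : Tendsto (fun y : ℝ => ((0 : ℝ), y)) (𝓝 0) (𝓝 0) :=
    (by fun_prop : Continuous fun y : ℝ => ((0 : ℝ), y)).tendsto 0
  induction k with
  | zero => rfl
  | succ k ih =>
    rw [Function.iterate_succ', Function.iterate_succ']
    refine EventuallyEq.trans ?_ ih.deriv
    filter_upwards [hline.eventually (analyticAt_iterate_derivSnd hF k).eventually_analyticAt]
      with y hy
    exact (hasDerivAt_derivSnd hy.differentiableAt).deriv.symm

/-- The translation depends on x alone, so it commutes with differentiation in y. -/
theorem iterate_derivSnd_shift {F : ℝ × ℝ → ℝ} (hF : AnalyticAt ℝ F 0) {c : ℝ → ℝ}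
    (hc : AnalyticAt ℝ c 0) (hc0 : c 0 = 0) (k : ℕ) :
    (derivSnd^[k] fun p => F (p.1, c p.1 + p.2)) =ᶠ[𝓝 0]
      fun p => (derivSnd^[k] F) (p.1, c p.1 + p.2) := by
  have hcA : ∀ᶠ p : ℝ × ℝ in 𝓝 0, AnalyticAt ℝ c p.1 :=
    (continuousAt_fst (p := (0 : ℝ × ℝ))).eventually hc.eventually_analyticAt
  have hcA' : ∀ {p : ℝ × ℝ}, AnalyticAt ℝ c p.1 →
      AnalyticAt ℝ (fun p : ℝ × ℝ => (p.1, c p.1 + p.2)) p := fun h =>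
    analyticAt_fst.prod ((AnalyticAt.fun_comp (f := Prod.fst) h analyticAt_fst).add analyticAt_snd)
  have htend : Tendsto (fun p : ℝ × ℝ => (p.1, c p.1 + p.2)) (𝓝 0) (𝓝 0) := by
    have := (hcA' (p := (0 : ℝ × ℝ)) hc).continuousAt.tendsto
    rwa [show ((0 : ℝ × ℝ).1, c (0 : ℝ × ℝ).1 + (0 : ℝ × ℝ).2) = 0 by simp [hc0]] at this
  induction k with
  | zero => rfl
  | succ k ih =>
    rw [Function.iterate_succ']
    refine (derivSnd_congr ih).trans ?_
    filter_upwards [htend.eventually (analyticAt_iterate_derivSnd hF k).eventually_analyticAt, hcA]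
      with p hp hcp
    refine derivSnd_eq_of_hasDerivAt (AnalyticAt.fun_comp hp (hcA' hcp)) ?_
    have h1 : HasDerivAt (fun s => c p.1 + s) 1 p.2 := (hasDerivAt_id p.2).const_add _
    have h2 := HasDerivAt.comp (h := fun s => c p.1 + s) p.2
      (hasDerivAt_derivSnd hp.differentiableAt) h1
    exact h2.congr_deriv (mul_one _)

/-- The order of a polynomial function at a point is the multiplicity of the point as a root. -/
theorem analyticOrderAt_polynomial {P : Polynomial ℝ} (hP : P ≠ 0) (z : ℝ) :
    analyticOrderAt (fun x => P.eval x) z = P.rootMultiplicity z := by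
  have hA : ∀ Q : Polynomial ℝ, AnalyticAt ℝ (fun x => Q.eval x) z := fun Q =>
    AnalyticOnNhd.eval_polynomial Q z (mem_univ z)
  obtain ⟨Q, hQ, hnd⟩ := P.exists_eq_pow_rootMultiplicity_mul_and_not_dvd hP z
  rw [(hA P).analyticOrderAt_eq_natCast]
  refine ⟨fun x => Q.eval x, hA Q, fun h => hnd (Polynomial.dvd_iff_isRoot.2 h),
    Eventually.of_forall fun x => ?_⟩
  conv_lhs => rw [hQ]
  simp

/-- An expansion of a function of order `n` without terms of degree between `k` and `n`. -/
theorem expansion_of_order {g v : ℝ → ℝ} {b : ℕ → ℝ} {k n : ℕ} (hk : k ≤ n)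
    (hg : AnalyticAt ℝ g 0) (hv : AnalyticAt ℝ v 0) (hord : analyticOrderAt g 0 = n)
    (h : ∀ᶠ y in 𝓝 (0 : ℝ), g y = ∑ i ∈ Finset.range k, y ^ i * b i + y ^ n * v y) :
    (∀ i < k, b i = 0) ∧ v 0 ≠ 0 := by
  set P : Polynomial ℝ := ∑ i ∈ Finset.range k, Polynomial.monomial i (b i) with hPdef
  have hPe : ∀ y, P.eval y = ∑ i ∈ Finset.range k, y ^ i * b i := fun y => by
    simp [hPdef, Polynomial.eval_finsetSum, mul_comm]
  have hPc : ∀ i < k, P.coeff i = b i := fun i hi => by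
    simp [hPdef, Polynomial.finsetSum_coeff, Polynomial.coeff_monomial, hi]
  have hPd : P.degree < k := by
    refine (Polynomial.degree_sum_le _ _).trans_lt ?_
    rw [Finset.sup_lt_iff (WithBot.bot_lt_coe _)]
    intro i hi
    exact (Polynomial.degree_monomial_le _ _).trans_lt (by exact_mod_cast Finset.mem_range.1 hi)
  obtain ⟨g₀, hg₀, hg₀0, hgg₀⟩ := hg.analyticOrderAt_eq_natCast.1 hord
  -- P equals y^n times an analytic function, so it vanishes to order at least n at 0, whereas its
  -- degree is less than k ≤ n.
  have hP0 : P = 0 := by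
    by_contra hP
    have h1 := analyticOrderAt_polynomial hP 0
    have h2 : (n : ℕ∞) ≤ analyticOrderAt (fun y => P.eval y) 0 := by
      rw [natCast_le_analyticOrderAt (AnalyticOnNhd.eval_polynomial P 0 (mem_univ _))]
      refine ⟨fun y => g₀ y - v y, hg₀.sub hv, ?_⟩
      filter_upwards [h, hgg₀] with y h3 h4
      rw [h4, sub_zero, smul_eq_mul] at h3
      rw [hPe, sub_zero, smul_eq_mul]
      linarith
    rw [h1] at h2
    have h3 : n ≤ P.rootMultiplicity 0 := by exact_mod_cast h2
    have h4 : P.rootMultiplicity 0 ≤ P.natDegree := by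
      rw [← Polynomial.count_roots]
      exact (Multiset.count_le_card _ _).trans (Polynomial.card_roots' P)
    have h5 : P.natDegree < k := (Polynomial.natDegree_lt_iff_degree_lt hP).2 hPd
    omega
  refine ⟨fun i hi => by rw [← hPc i hi, hP0, Polynomial.coeff_zero], fun hv0 => ?_⟩
  have h1 : g =ᶠ[𝓝 0] fun y => (y - 0) ^ n • v y := by
    filter_upwards [h] with y hy
    rw [hy, ← hPe, hP0]
    simp
  have h2 : (fun y => (y - 0) ^ n • g₀ y) =ᶠ[𝓝 0] fun y => (y - 0) ^ n • v y :=
    (EventuallyEq.symm hgg₀).trans h1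
  have h3 : ∀ᶠ y in 𝓝[≠] (0 : ℝ), g₀ y = v y := by
    filter_upwards [h2.filter_mono nhdsWithin_le_nhds, self_mem_nhdsWithin] with y hy hne
    have hne : y ≠ 0 := hne
    simpa [hne] using hy
  have h4 := (hg₀.frequently_eq_iff_eventually_eq hv).1 h3.frequently
  exact hg₀0 (h4.self_of_nhds.trans hv0)

/-- Normal form of a function of two variables of order `n` along the vertical axis, where the term
of degree `n - 1` has been removed by a translation. -/
theorem exists_preparation {F : ℝ × ℝ → ℝ} (hF : AnalyticAt ℝ F 0) {n : ℕ} (hn : n ≠ 0)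
    (hord : analyticOrderAt (fun y => F (0, y)) 0 = n) :
    ∃ (c : ℝ → ℝ) (a : ℕ → ℝ → ℝ) (u : ℝ × ℝ → ℝ), AnalyticAt ℝ c 0 ∧ c 0 = 0 ∧
      (∀ i, AnalyticAt ℝ (a i) 0) ∧ (∀ i < n - 1, a i 0 = 0) ∧ AnalyticAt ℝ u 0 ∧ u 0 ≠ 0 ∧
      ∀ᶠ p in 𝓝 0, F (p.1, c p.1 + p.2) =
        ∑ i ∈ Finset.range (n - 1), p.2 ^ i * a i p.1 + p.2 ^ n * u p := by
  have hlineA : AnalyticAt ℝ (fun y : ℝ => ((0 : ℝ), y)) 0 := analyticAt_const.prod analyticAt_id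
  have hFl : AnalyticAt ℝ (fun y => F (0, y)) 0 := AnalyticAt.fun_comp (x := (0 : ℝ)) hF hlineA
  have hvals : ∀ k ≤ n, analyticOrderAt (fun y => (derivSnd^[k] F) (0, y)) 0 = (n - k : ℕ) :=
    fun k hk => by
      rw [analyticOrderAt_congr (iterate_derivSnd_line hF k)]
      exact analyticOrderAt_iterated_deriv hFl hord.symm hn hk
  have hkl : ∀ k, AnalyticAt ℝ (fun y => (derivSnd^[k] F) (0, y)) 0 := fun k =>
    AnalyticAt.fun_comp (x := (0 : ℝ)) (analyticAt_iterate_derivSnd hF k) hlineA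
  have h0 : (derivSnd^[n - 1] F) 0 = 0 := by
    have := hvals (n - 1) (by omega)
    rw [show n - (n - 1) = 1 by omega] at this
    exact apply_eq_zero_of_analyticOrderAt_ne_zero (f := fun y => (derivSnd^[n - 1] F) (0, y))
      (by rw [this]; simp)
  have h1 : derivSnd (derivSnd^[n - 1] F) 0 ≠ 0 := by
    have := hvals n le_rfl
    rw [Nat.sub_self, Nat.cast_zero, (hkl n).analyticOrderAt_eq_zero] at this
    rw [show n = (n - 1) + 1 by omega, Function.iterate_succ_apply'] at this
    exact this
  -- The translation follows the zero c(x) of the derivative of order n - 1 in y, which is a graph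
  -- because the derivative of order n is nonzero at 0. The coefficient of degree n - 1 of the
  -- translated function then vanishes.
  obtain ⟨c, hc, hc0, hcF⟩ :=
    exists_analytic_implicit (analyticAt_iterate_derivSnd hF (n - 1)) h0 h1
  set G : ℝ × ℝ → ℝ := fun p => F (p.1, c p.1 + p.2) with hGdef
  have hG : AnalyticAt ℝ G 0 := by
    refine AnalyticAt.fun_comp (x := (0 : ℝ × ℝ)) (f := fun p : ℝ × ℝ => (p.1, c p.1 + p.2)) ?_
      (analyticAt_fst.prod ((AnalyticAt.fun_comp (x := (0 : ℝ × ℝ)) (f := Prod.fst) hc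
        analyticAt_fst).add analyticAt_snd))
    have : ((0 : ℝ × ℝ).1, c (0 : ℝ × ℝ).1 + (0 : ℝ × ℝ).2) = 0 := by simp [hc0]
    rw [this]; exact hF
  obtain ⟨a, w, ha, hw, hGw⟩ := exists_taylor_snd hG (n - 1)
  obtain ⟨u, hu, hwu⟩ := exists_eq_add_snd_smul hw
  have hline : Tendsto (fun x : ℝ => (x, (0 : ℝ))) (𝓝 0) (𝓝 0) :=
    (by fun_prop : Continuous fun x : ℝ => (x, (0 : ℝ))).tendsto 0
  have hw0 : ∀ᶠ x in 𝓝 (0 : ℝ), w (x, 0) = 0 := by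
    filter_upwards [iterate_derivSnd_eq ha hw hG hGw, hcF,
      hline.eventually (iterate_derivSnd_shift hF hc hc0 (n - 1))] with x h2 h3 h4
    rw [h4] at h2
    simp only [add_zero, h3] at h2
    have : ((n - 1).factorial : ℝ) ≠ 0 := by positivity
    exact (mul_eq_zero.1 h2.symm).resolve_left this
  have hGu : ∀ᶠ p in 𝓝 0, G p =
      ∑ i ∈ Finset.range (n - 1), p.2 ^ i * a i p.1 + p.2 ^ n * u p := by
    filter_upwards [hGw, hwu, (continuousAt_fst (p := (0 : ℝ × ℝ))).eventually hw0] with p h2 h3 h4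
    rw [h2, h3, h4, zero_add, smul_eq_mul]
    obtain ⟨m, rfl⟩ := Nat.exists_eq_succ_of_ne_zero hn
    simp only [Nat.succ_eq_add_one, Nat.add_sub_cancel]
    ring
  have hvl : Tendsto (fun y : ℝ => ((0 : ℝ), y)) (𝓝 0) (𝓝 0) :=
    (by fun_prop : Continuous fun y : ℝ => ((0 : ℝ), y)).tendsto 0
  have hexp := expansion_of_order (g := fun y => F (0, y)) (v := fun y => u (0, y))
    (b := fun i => a i 0) (Nat.sub_le n 1) hFl
    (AnalyticAt.fun_comp (x := (0 : ℝ)) hu hlineA) hord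
    ((hvl.eventually hGu).mono fun y hy => by simpa [hGdef, hc0] using hy)
  exact ⟨c, a, u, hc, hc0, ha, hexp.1, hu, hexp.2, hGu⟩

end Preparation

end SurfaceFlow

namespace SurfaceFlow

/-! ### Arcs, Newton polygon and bounds on roots. -/

section CurveSelection

open Set Filter

/-- A root of full multiplicity would give P = q (X - z)^n. The coefficient of degree n - 1 is then
-n z q, which forces z = 0 and P = q X^n, against the nonzero coefficient i. This strict inequality
is what makes the order drop after a blow-up. -/
theorem rootMultiplicity_lt_natDegree {P : Polynomial ℝ} {i : ℕ} (hi : i + 1 < P.natDegree)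
    (h1 : P.coeff (P.natDegree - 1) = 0) (h2 : P.coeff i ≠ 0) (z : ℝ) :
    P.rootMultiplicity z < P.natDegree := by
  by_contra! hle
  have hP : P ≠ 0 := fun h => h2 (by simp [h])
  have hdvd : (Polynomial.X - Polynomial.C z) ^ P.natDegree ∣ P :=
    (Polynomial.le_rootMultiplicity_iff hP).1 hle
  obtain ⟨Q, hQ⟩ := hdvd
  have hmon := (Polynomial.monic_X_sub_C z).pow P.natDegree
  have hQ0 : Q ≠ 0 := fun h => hP (by rw [hQ, h, mul_zero])
  have hQd : Q.natDegree = 0 := by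
    have := congrArg Polynomial.natDegree hQ
    rw [hmon.natDegree_mul' hQ0, Polynomial.natDegree_pow, Polynomial.natDegree_X_sub_C] at this
    omega
  rw [Polynomial.eq_C_of_natDegree_eq_zero hQd] at hQ
  have hcoef : ∀ j, P.coeff j =
      (-z) ^ (P.natDegree - j) * (P.natDegree.choose j : ℝ) * Q.coeff 0 := fun j => by
    conv_lhs => rw [hQ]
    rw [Polynomial.coeff_mul_C, sub_eq_add_neg, ← Polynomial.C_neg, Polynomial.coeff_X_add_C_pow]
  have hz : z = 0 := by
    have h3 := hcoef (P.natDegree - 1)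
    rw [h1, show P.natDegree - (P.natDegree - 1) = 1 by omega, pow_one] at h3
    have h4 : (P.natDegree.choose (P.natDegree - 1) : ℝ) ≠ 0 := by
      exact_mod_cast (Nat.choose_pos (Nat.sub_le _ _)).ne'
    have h5 : Q.coeff 0 ≠ 0 := fun h => hP (by rw [hQ, h]; simp)
    rcases mul_eq_zero.1 h3.symm with h | h
    · rcases mul_eq_zero.1 h with h | h
      · exact neg_eq_zero.1 h
      · exact absurd h h4
    · exact absurd h h5
  refine h2 ?_
  rw [hcoef i, hz, neg_zero, zero_pow (by omega), zero_mul, zero_mul]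

/-- Every analytic arc `t ↦ (t ^ m, φ t)` starting at the origin remains in `S` for small `t > 0`. -/
def ContainsArcs (S : Set (ℝ × ℝ)) : Prop :=
  ∀ (m : ℕ) (φ : ℝ → ℝ), m ≠ 0 → AnalyticAt ℝ φ 0 → φ 0 = 0 →
    ∀ᶠ t in 𝓝[>] (0 : ℝ), (t ^ m, φ t) ∈ S

theorem ContainsArcs.shear {S : Set (ℝ × ℝ)} (hS : ContainsArcs S) {c : ℝ → ℝ}
    (hc : AnalyticAt ℝ c 0) (hc0 : c 0 = 0) : ContainsArcs {p | (p.1, c p.1 + p.2) ∈ S} := by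
  intro m φ hm hφ hφ0
  refine hS m (fun t => c (t ^ m) + φ t) hm (AnalyticAt.add ?_ hφ) (by simp [hm, hc0, hφ0])
  refine AnalyticAt.fun_comp (x := (0 : ℝ)) (f := fun t : ℝ => t ^ m) ?_ (analyticAt_id.pow m)
  simpa [hm] using hc

/-- An arc with first coordinate t^l is sent to one with first coordinate t^(l m): arcs with a power
of t as abscissa are stable under blow-up. -/
theorem ContainsArcs.blowUp {S : Set (ℝ × ℝ)} (hS : ContainsArcs S) {m k : ℕ} (hm : m ≠ 0)
    (hk : k ≠ 0) (z : ℝ) : ContainsArcs {p | (p.1 ^ m, p.1 ^ k * (z + p.2)) ∈ S} := by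
  intro l φ hl hφ _
  have h := hS (l * m) (fun t => (t ^ l) ^ k * (z + φ t)) (mul_ne_zero hl hm)
    (((analyticAt_id.pow l).pow k).mul (analyticAt_const.add hφ)) (by simp [hl, hk])
  refine h.mono fun t ht => ?_
  change ((t ^ l) ^ m, (t ^ l) ^ k * (z + φ t)) ∈ S
  rwa [← pow_mul t l m]

/-- The coefficients after the substitution `x = t ^ m` given by a side of the Newton polygon. -/
theorem exists_newton_side {n : ℕ} {a : ℕ → ℝ → ℝ} (ha : ∀ i, AnalyticAt ℝ (a i) 0)
    (ha0 : ∀ i < n - 1, a i 0 = 0) (hne : ∃ i < n - 1, ¬ ∀ᶠ x in 𝓝 (0 : ℝ), a i x = 0) :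
    ∃ (m k j : ℕ) (g : ℕ → ℝ → ℝ), m ≠ 0 ∧ k ≠ 0 ∧ j < n - 1 ∧ (∀ i, AnalyticAt ℝ (g i) 0) ∧
      g j 0 ≠ 0 ∧ ∀ i < n - 1, ∀ᶠ t in 𝓝 (0 : ℝ), a i (t ^ m) = t ^ (k * (n - i)) * g i t := by
  classical
  have hfac : ∀ i, (¬ ∀ᶠ x in 𝓝 (0 : ℝ), a i x = 0) → ∃ (d : ℕ) (b : ℝ → ℝ), AnalyticAt ℝ b 0 ∧
      b 0 ≠ 0 ∧ ∀ᶠ x in 𝓝 (0 : ℝ), a i x = x ^ d * b x := by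
    intro i hi
    have h1 : analyticOrderAt (a i) 0 ≠ ⊤ := fun h => hi (analyticOrderAt_eq_top.1 h)
    obtain ⟨b, hb, hb0, h⟩ := ((ha i).analyticOrderAt_ne_top).1 h1
    exact ⟨_, b, hb, hb0, h.mono fun x hx => by simpa using hx⟩
  choose! d b hb hb0 hab using hfac
  set I := (Finset.range (n - 1)).filter fun i => ¬ ∀ᶠ x in 𝓝 (0 : ℝ), a i x = 0 with hI
  obtain ⟨i₀, hi₀, hi₀'⟩ := hne
  -- The index j minimises the slope d i / (n - i), where d i is the order of the coefficient `a i`.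
  obtain ⟨j, hj, hmin⟩ := I.exists_min_image (fun i => (d i : ℚ) / ((n - i : ℕ) : ℚ))
    ⟨i₀, by simp only [hI, Finset.mem_filter, Finset.mem_range]; exact ⟨hi₀, hi₀'⟩⟩
  simp only [hI, Finset.mem_filter, Finset.mem_range] at hj hmin
  obtain ⟨hjn, hj0⟩ := hj
  have hle : ∀ i < n - 1, (¬ ∀ᶠ x in 𝓝 (0 : ℝ), a i x = 0) → d j * (n - i) ≤ (n - j) * d i := by
    intro i hi hi'
    have h1 := hmin i ⟨hi, hi'⟩
    rw [div_le_div_iff₀ (by exact_mod_cast (by omega : 0 < n - j))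
      (by exact_mod_cast (by omega : 0 < n - i))] at h1
    rw [mul_comm (n - j)]
    exact_mod_cast h1
  have hdj : d j ≠ 0 := by
    intro h
    have h1 := (hab j hj0).self_of_nhds
    rw [ha0 j hjn, h, pow_zero, one_mul] at h1
    exact hb0 j hj0 h1.symm
  have hm : n - j ≠ 0 := by omega
  have htend : Tendsto (fun t : ℝ => t ^ (n - j)) (𝓝 0) (𝓝 0) := by
    have := (continuous_pow (M := ℝ) (n - j)).tendsto 0
    rwa [zero_pow hm] at this
  -- With x = t^(n-j) and y = t^(d j) z, each term `a i` y^i is divisible by t^(d j * n) by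
  -- minimality of the slope; for i = j nothing more can be factored out, so `g j 0 ≠ 0`. The
  -- truncated subtraction in the exponent is exact by `hle`.
  refine ⟨n - j, d j, j, fun i t => if (∀ᶠ x in 𝓝 (0 : ℝ), a i x = 0) then 0 else
    t ^ ((n - j) * d i - d j * (n - i)) * b i (t ^ (n - j)), hm, hdj, hjn, fun i => ?_, ?_, ?_⟩
  · by_cases hi : ∀ᶠ x in 𝓝 (0 : ℝ), a i x = 0
    · simpa only [hi, if_true] using analyticAt_const
    · simp only [hi, if_false]
      refine (analyticAt_id.pow _).mul ?_
      refine AnalyticAt.fun_comp (x := (0 : ℝ)) (f := fun t : ℝ => t ^ (n - j)) ?_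
        (analyticAt_id.pow _)
      rw [zero_pow hm]
      exact hb i hi
  · simp only [hj0, if_false]
    rw [mul_comm (n - j), Nat.sub_self, pow_zero, one_mul, zero_pow hm]
    exact hb0 j hj0
  · intro i hi
    by_cases hi' : ∀ᶠ x in 𝓝 (0 : ℝ), a i x = 0
    · simp only [hi', if_true, mul_zero]
      exact htend.eventually hi'
    · simp only [hi', if_false]
      refine (htend.eventually (hab i hi')).mono fun t ht => ?_
      rw [ht, ← pow_mul, ← mul_assoc, ← pow_add, Nat.add_sub_cancel' (hle i hi hi')]

/-- The missing top coefficients and the lower bound on v keep all roots z in a fixed interval; this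
supplies the compactness used after the blow-up. -/
theorem abs_le_of_root {n : ℕ} (hn : n ≠ 0) {z v δ C : ℝ} {b : ℕ → ℝ} (hδ : 0 < δ) (hv : δ ≤ |v|)
    (hb : ∀ i < n - 1, |b i| ≤ C) (hC : 0 ≤ C)
    (h : ∑ i ∈ Finset.range (n - 1), z ^ i * b i + z ^ n * v = 0) :
    |z| ≤ max 1 (n * C / δ) := by
  rcases le_total |z| 1 with hz | hz
  · exact hz.trans (le_max_left _ _)
  refine le_max_of_le_right ?_
  rw [le_div_iff₀ hδ]
  have h1 : |z| ^ n * δ ≤ n * (|z| ^ (n - 1) * C) := by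
    calc |z| ^ n * δ ≤ |z| ^ n * |v| := by gcongr
      _ = |z ^ n * v| := by rw [abs_mul, abs_pow]
      _ = |∑ i ∈ Finset.range (n - 1), z ^ i * b i| := by
          rw [← abs_neg]; congr 1; linarith
      _ ≤ ∑ i ∈ Finset.range (n - 1), |z ^ i * b i| := Finset.abs_sum_le_sum_abs _ _
      _ ≤ ∑ i ∈ Finset.range (n - 1), |z| ^ (n - 1) * C := by
          refine Finset.sum_le_sum fun i hi => ?_
          have hi := Finset.mem_range.1 hi
          rw [abs_mul, abs_pow]
          exact mul_le_mul (pow_le_pow_right₀ hz hi.le) (hb i hi) (abs_nonneg _) (by positivity)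
      _ = (n - 1 : ℕ) * (|z| ^ (n - 1) * C) := by simp
      _ ≤ n * (|z| ^ (n - 1) * C) := by gcongr; exact Nat.sub_le _ _
  have h2 : |z| ^ n = |z| ^ (n - 1) * |z| := by
    rw [← pow_succ, Nat.sub_add_cancel (Nat.one_le_iff_ne_zero.2 hn)]
  have h3 : 0 < |z| ^ (n - 1) := by positivity
  rw [h2] at h1
  refine le_of_mul_le_mul_left ?_ h3
  linarith

end CurveSelection

end SurfaceFlow

namespace SurfaceFlow

/-! ### Curve selection by induction on the order in y. -/

section CurveSelection

open Set Filter

/-- Containing all analytic arcs implies containing all zeros, in the right half-plane near the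
origin, of functions of order `n`. -/
def ArcsSelectZeros (n : ℕ) : Prop :=
  ∀ (F : ℝ × ℝ → ℝ) (S : Set (ℝ × ℝ)), AnalyticAt ℝ F 0 →
    analyticOrderAt (fun y => F (0, y)) 0 = n → ContainsArcs S →
      ∀ᶠ p : ℝ × ℝ in 𝓝 0, 0 < p.1 → F p = 0 → p ∈ S

/-- On t = 0 the blown-up equation is a polynomial P(z) of degree n, with no term of degree n - 1
and a nonzero coefficient j. Its order at any z is thus less than n, possibly 0, and the induction
hypothesis applies there. -/
theorem eventually_mem_of_weighted {n m k j : ℕ} (hm : m ≠ 0) (hk : k ≠ 0) (hj : j < n - 1)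
    (ih : ∀ l < n, ArcsSelectZeros l) {S : Set (ℝ × ℝ)} (hS : ContainsArcs S)
    {g : ℕ → ℝ → ℝ} (hg : ∀ i, AnalyticAt ℝ (g i) 0) (hgj : g j 0 ≠ 0)
    {u : ℝ × ℝ → ℝ} (hu : AnalyticAt ℝ u 0) (hu0 : u 0 ≠ 0) (z : ℝ) :
    ∀ᶠ p : ℝ × ℝ in 𝓝 (0, z), 0 < p.1 →
      ∑ i ∈ Finset.range (n - 1), p.2 ^ i * g i p.1 + p.2 ^ n * u (p.1 ^ m, p.1 ^ k * p.2) = 0 →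
        (p.1 ^ m, p.1 ^ k * p.2) ∈ S := by
  have hn : n ≠ 0 := by omega
  set F : ℝ × ℝ → ℝ := fun p => ∑ i ∈ Finset.range (n - 1), (z + p.2) ^ i * g i p.1 +
    (z + p.2) ^ n * u (p.1 ^ m, p.1 ^ k * (z + p.2)) with hF
  have hz : AnalyticAt ℝ (fun p : ℝ × ℝ => z + p.2) 0 := analyticAt_const.add analyticAt_snd
  have hFA : AnalyticAt ℝ F 0 := by
    refine AnalyticAt.add (Finset.analyticAt_fun_sum _ fun i _ => (hz.pow i).mul ?_)
      ((hz.pow n).mul ?_)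
    · exact AnalyticAt.fun_comp (x := (0 : ℝ × ℝ)) (f := Prod.fst) (hg i) analyticAt_fst
    · refine AnalyticAt.fun_comp (x := (0 : ℝ × ℝ))
        (f := fun p : ℝ × ℝ => (p.1 ^ m, p.1 ^ k * (z + p.2))) ?_
        ((analyticAt_fst.pow m).prod ((analyticAt_fst.pow k).mul hz))
      have : ((0 : ℝ × ℝ).1 ^ m, (0 : ℝ × ℝ).1 ^ k * (z + (0 : ℝ × ℝ).2)) = 0 := by
        simp [hm, hk]
      rwa [this]
  set P : Polynomial ℝ := ∑ i ∈ Finset.range (n - 1), Polynomial.monomial i (g i 0) +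
    Polynomial.monomial n (u 0) with hP
  have hPe : ∀ y, P.eval y = ∑ i ∈ Finset.range (n - 1), y ^ i * g i 0 + y ^ n * u 0 := fun y => by
    simp [hP, Polynomial.eval_finsetSum, mul_comm]
  have hPc : ∀ i, P.coeff i = (if i < n - 1 then g i 0 else 0) + if n = i then u 0 else 0 :=
    fun i => by simp [hP, Polynomial.finsetSum_coeff, Polynomial.coeff_monomial]
  have hPd : P.natDegree = n := by
    refine Polynomial.natDegree_eq_of_le_of_coeff_ne_zero ?_ ?_
    · refine Polynomial.natDegree_le_iff_coeff_eq_zero.2 fun i hi => ?_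
      rw [hPc, if_neg (by omega), if_neg (by omega), add_zero]
    · rw [hPc, if_neg (by omega), if_pos rfl, zero_add]
      exact hu0
  have hlt : P.rootMultiplicity z < n := by
    have := rootMultiplicity_lt_natDegree (P := P) (i := j) (by omega) ?_ ?_ z
    · rwa [hPd] at this
    · rw [hPd, hPc, if_neg (by omega), if_neg (by omega), add_zero]
    · rwa [hPc, if_pos hj, if_neg (by omega), add_zero]
  have hP0 : P ≠ 0 := fun h => by rw [h] at hPd; simp at hPd; omega
  have hord : analyticOrderAt (fun y => F (0, y)) 0 = P.rootMultiplicity z := by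
    rw [Polynomial.rootMultiplicity_eq_rootMultiplicity,
      ← analyticOrderAt_polynomial ((Polynomial.comp_X_add_C_ne_zero_iff).2 hP0)]
    congr 1
    funext y
    have h0 : ((0 : ℝ), (0 : ℝ)) = (0 : ℝ × ℝ) := rfl
    simp [hF, hPe, hm, hk, h0, add_comm y z]
  have key := ih _ hlt F _ hFA hord (hS.blowUp hm hk z)
  have htend : Tendsto (fun p : ℝ × ℝ => (p.1, p.2 - z)) (𝓝 (0, z)) (𝓝 0) := by
    have := (by fun_prop : Continuous fun p : ℝ × ℝ => (p.1, p.2 - z)).tendsto (0, z)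
    rwa [show ((0 : ℝ), z - z) = (0 : ℝ × ℝ) by rw [sub_self]; rfl] at this
  filter_upwards [htend.eventually key] with p hp h1 h2
  have := hp h1 (by simpa only [hF, add_sub_cancel] using h2)
  simpa only [mem_ofPred_eq, add_sub_cancel] using this

theorem eventually_mem_of_prepared {n : ℕ} (hn : n ≠ 0) (ih : ∀ l < n, ArcsSelectZeros l)
    {S : Set (ℝ × ℝ)} (hS : ContainsArcs S) {a : ℕ → ℝ → ℝ} (ha : ∀ i, AnalyticAt ℝ (a i) 0)
    (ha0 : ∀ i < n - 1, a i 0 = 0) {u : ℝ × ℝ → ℝ} (hu : AnalyticAt ℝ u 0) (hu0 : u 0 ≠ 0) :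
    ∀ᶠ p : ℝ × ℝ in 𝓝 0, 0 < p.1 →
      ∑ i ∈ Finset.range (n - 1), p.2 ^ i * a i p.1 + p.2 ^ n * u p = 0 → p ∈ S := by
  have hfst : Tendsto (fun p : ℝ × ℝ => p.1) (𝓝 0) (𝓝 0) := continuousAt_fst (p := (0 : ℝ × ℝ))
  have hune : ∀ᶠ p in 𝓝 (0 : ℝ × ℝ), u p ≠ 0 := hu.continuousAt.eventually_ne hu0
  by_cases hne : ∃ i < n - 1, ¬ ∀ᶠ x in 𝓝 (0 : ℝ), a i x = 0
  swap
  -- All lower coefficients vanish identically, so the zeros form the axis y = 0, which is the arc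
  -- with m = 1 and φ = 0.
  · push Not at hne
    have hall : ∀ᶠ x in 𝓝 (0 : ℝ), ∀ i ∈ Finset.range (n - 1), a i x = 0 :=
      (Finset.eventually_all _).2 fun i hi => hne i (Finset.mem_range.1 hi)
    have harc := eventually_nhdsWithin_iff.1 (hS 1 (fun _ => 0) one_ne_zero analyticAt_const rfl)
    filter_upwards [hfst.eventually hall, hfst.eventually harc, hune] with p h1 h2 h3 hpos h4
    rw [Finset.sum_eq_zero fun i hi => by rw [h1 i hi, mul_zero], zero_add] at h4
    have h5 : p.2 = 0 := by
      rcases mul_eq_zero.1 h4 with h | h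
      · exact pow_eq_zero_iff hn |>.1 h
      · exact absurd h h3
    have h6 := h2 hpos
    rwa [pow_one, ← h5] at h6
  · obtain ⟨m, k, j, g, hm, hk, hj, hg, hgj, hag⟩ := exists_newton_side ha ha0 hne
    have hag' : ∀ᶠ t in 𝓝 (0 : ℝ), ∀ i ∈ Finset.range (n - 1),
        a i (t ^ m) = t ^ (k * (n - i)) * g i t :=
      (Finset.eventually_all _).2 fun i hi => hag i (Finset.mem_range.1 hi)
    set C : ℝ := ∑ i ∈ Finset.range (n - 1), (|g i 0| + 1) with hC
    have hC0 : 0 ≤ C := Finset.sum_nonneg fun i _ => by positivity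
    have hgb : ∀ᶠ t in 𝓝 (0 : ℝ), ∀ i ∈ Finset.range (n - 1), |g i t| ≤ C := by
      refine (Finset.eventually_all _).2 fun i hi => ?_
      have h1 : ∀ᶠ t in 𝓝 (0 : ℝ), |g i t| < |g i 0| + 1 :=
        (hg i).continuousAt.abs.eventually_lt continuousAt_const (lt_add_one _)
      refine h1.mono fun t ht => ht.le.trans ?_
      exact Finset.single_le_sum (f := fun i => |g i 0| + 1) (fun i _ => by positivity) hi
    have hub : ∀ᶠ p in 𝓝 (0 : ℝ × ℝ), |u 0| / 2 < |u p| :=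
      continuousAt_const.eventually_lt hu.continuousAt.abs (half_lt_self (abs_pos.2 hu0))
    set R : ℝ := max 1 (n * C / (|u 0| / 2)) with hR
    -- The neighbourhoods obtained at the individual z are made uniform by compactness of the
    -- interval that contains all roots.
    have hcomp : ∀ᶠ t in 𝓝 (0 : ℝ), ∀ z ∈ Icc (-R) R, 0 < t →
        ∑ i ∈ Finset.range (n - 1), z ^ i * g i t + z ^ n * u (t ^ m, t ^ k * z) = 0 →
          (t ^ m, t ^ k * z) ∈ S :=
      isCompact_Icc.eventually_forall_of_forall_eventually fun z _ =>
        eventually_mem_of_weighted hm hk hj ih hS hg hgj hu hu0 z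
    have hroot : Tendsto (fun p : ℝ × ℝ => p.1 ^ (m : ℝ)⁻¹) (𝓝 0) (𝓝 0) := by
      have h1 : Continuous fun p : ℝ × ℝ => p.1 ^ (m : ℝ)⁻¹ :=
        (Real.continuous_rpow_const (by positivity)).comp continuous_fst
      have h2 := h1.tendsto 0
      have h3 : (0 : ℝ × ℝ).1 ^ (m : ℝ)⁻¹ = 0 := Real.zero_rpow (by positivity)
      rwa [h3] at h2
    filter_upwards [hroot.eventually hag', hroot.eventually hgb, hub, hroot.eventually hcomp]
      with p h1 h2 h3 h4 hpos h5
    set t : ℝ := p.1 ^ (m : ℝ)⁻¹ with ht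
    have htpos : 0 < t := Real.rpow_pos_of_pos hpos _
    have htm : t ^ m = p.1 := Real.rpow_inv_natCast_pow hpos.le hm
    set z : ℝ := p.2 / t ^ k with hz
    have hzk : t ^ k * z = p.2 := by rw [hz]; field_simp
    have hp : (t ^ m, t ^ k * z) = p := by rw [htm, hzk]
    have h6 : ∑ i ∈ Finset.range (n - 1), z ^ i * g i t + z ^ n * u p = 0 := by
      -- The equation in (x, y) is t^(k n) times the equation in (t, z).
      have h7 : t ^ (k * n) * (∑ i ∈ Finset.range (n - 1), z ^ i * g i t + z ^ n * u p) = 0 := by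
        rw [← h5, mul_add, Finset.mul_sum]
        congr 1
        · refine Finset.sum_congr rfl fun i hi => ?_
          have hin : i ≤ n := by have := Finset.mem_range.1 hi; omega
          have h8 := h1 i hi
          rw [htm] at h8
          rw [h8, ← hzk, mul_pow, ← pow_mul]
          have h9 : t ^ (k * n) = t ^ (k * i) * t ^ (k * (n - i)) := by
            rw [← pow_add, ← mul_add, Nat.add_sub_cancel' hin]
          rw [h9]; ring
        · rw [← hzk, mul_pow, ← pow_mul]; ring
      exact (mul_eq_zero.1 h7).resolve_left (by positivity)
    have hzR : |z| ≤ R := abs_le_of_root hn (half_pos (abs_pos.2 hu0)) h3.le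
      (fun i hi => h2 i (Finset.mem_range.2 hi)) hC0 h6
    have := h4 z (abs_le.1 hzR) htpos (by rw [hp]; exact h6)
    rwa [hp] at this

/-- A form of the curve selection lemma. -/
theorem arcsSelectZeros (n : ℕ) : ArcsSelectZeros n := by
  induction n using Nat.strong_induction_on with
  | _ n ih =>
  intro F S hF hord hS
  rcases eq_or_ne n 0 with rfl | hn
  · have h1 : F 0 ≠ 0 := by
      have hA : AnalyticAt ℝ (fun y => F (0, y)) 0 :=
        AnalyticAt.fun_comp (x := (0 : ℝ)) (f := fun y : ℝ => ((0 : ℝ), y)) hF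
          (analyticAt_const.prod analyticAt_id)
      rw [Nat.cast_zero, hA.analyticOrderAt_eq_zero] at hord
      exact hord
    exact (hF.continuousAt.eventually_ne h1).mono fun p hp _ h => absurd h hp
  · obtain ⟨c, a, u, hc, hc0, ha, ha0, hu, hu0, hFu⟩ := exists_preparation hF hn hord
    have key := eventually_mem_of_prepared hn ih (hS.shear hc hc0) ha ha0 hu hu0
    have htend : Tendsto (fun p : ℝ × ℝ => (p.1, p.2 - c p.1)) (𝓝 0) (𝓝 0) := by
      have hcc : ContinuousAt (fun p : ℝ × ℝ => c p.1) 0 :=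
        ContinuousAt.comp (x := (0 : ℝ × ℝ)) (f := Prod.fst) hc.continuousAt continuousAt_fst
      have h1 : ContinuousAt (fun p : ℝ × ℝ => (p.1, p.2 - c p.1)) 0 :=
        continuousAt_fst.prodMk (continuousAt_snd.sub hcc)
      have h2 : ((0 : ℝ × ℝ).1, (0 : ℝ × ℝ).2 - c (0 : ℝ × ℝ).1) = 0 := by simp [hc0]
      rw [ContinuousAt, h2] at h1
      exact h1
    filter_upwards [htend.eventually key, htend.eventually hFu] with p h1 h2 hpos h3
    simp only [add_sub_cancel] at h2
    have := h1 hpos (by rw [← h2]; exact h3)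
    simpa only [mem_ofPred_eq, add_sub_cancel] using this

end CurveSelection

end SurfaceFlow

namespace SurfaceFlow

/-! ### Isolation of essential points in an analytic chart. -/

section LocalDiscreteness

open Set Filter

/-- The linear change of coordinates of the plane carrying `w ≠ 0` to `(0, 1)`. -/
noncomputable def straightenVector (w : ℝ × ℝ) (hw : w ≠ 0) : (ℝ × ℝ) ≃L[ℝ] (ℝ × ℝ) :=
  have hr : w.1 ^ 2 + w.2 ^ 2 ≠ 0 := fun h => hw <| by
    have h1 : w.1 = 0 := by nlinarith [sq_nonneg w.1, sq_nonneg w.2]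
    have h2 : w.2 = 0 := by nlinarith [sq_nonneg w.1, sq_nonneg w.2]
    exact Prod.ext h1 h2
  LinearEquiv.toContinuousLinearEquiv
    { toFun := fun p => (w.2 * p.1 - w.1 * p.2, (w.1 * p.1 + w.2 * p.2) / (w.1 ^ 2 + w.2 ^ 2))
      invFun := fun q => (w.2 * q.1 / (w.1 ^ 2 + w.2 ^ 2) + w.1 * q.2,
        -w.1 * q.1 / (w.1 ^ 2 + w.2 ^ 2) + w.2 * q.2)
      map_add' := fun p q => by
        ext
        · simp only [Prod.fst_add, Prod.snd_add]; ring
        · simp only [Prod.fst_add, Prod.snd_add]; ring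
      map_smul' := fun c p => by
        ext
        · simp only [Prod.smul_fst, Prod.smul_snd, smul_eq_mul, RingHom.id_apply]; ring
        · simp only [Prod.smul_fst, Prod.smul_snd, smul_eq_mul, RingHom.id_apply]; ring
      left_inv := fun p => by
        ext
        · simp only; field_simp; ring
        · simp only; field_simp; ring
      right_inv := fun q => by
        ext
        · simp only; field_simp; ring
        · simp only; field_simp; ring }

theorem straightenVector_symm_snd (w : ℝ × ℝ) (hw : w ≠ 0) (y : ℝ) :
    (straightenVector w hw).symm (0, y) = y • w := by
  change (w.2 * 0 / (w.1 ^ 2 + w.2 ^ 2) + w.1 * y, -w.1 * 0 / (w.1 ^ 2 + w.2 ^ 2) + w.2 * y) = _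
  ext
  · simp [mul_comm]
  · simp [mul_comm]

variable {X : Type*} [TopologicalSpace X] {Φ : Flow ℝ X} {e : OpenPartialHomeomorph X (ℝ × ℝ)}
  {V : ℝ × ℝ → ℝ × ℝ}

theorem AnalyticChart.transLinear (hc : AnalyticChart Φ e V) (L : (ℝ × ℝ) ≃L[ℝ] (ℝ × ℝ)) :
    AnalyticChart Φ (e.transHomeomorph L.toHomeomorph) (fun p => L (V (L.symm p))) where
  analytic p hp := by
    have h1 : AnalyticAt ℝ V (L.symm p) := hc.analytic _ hp
    exact AnalyticAt.fun_comp (L.analyticAt _) (AnalyticAt.fun_comp h1 (L.symm.analyticAt p))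
  deriv_zero q hq := by
    have h1 := hc.deriv_zero q hq
    have h2 := L.hasFDerivAt.comp_hasDerivAt (x := (0 : ℝ)) h1
    simpa [Function.comp_def] using h2
  sing q hq h := by
    refine hc.sing q hq ?_
    simpa using h

theorem AnalyticChart.notMem_of_ne_zero (hc : AnalyticChart Φ e V) {p : ℝ × ℝ} (hp : p ∈ e.target)
    (h : V p ≠ 0) : e.symm p ∉ essentialSingularSet Φ := fun hs => by
  have h1 := (hc.isSingular_iff (e.map_target hp)).1 hs.1
  rw [e.right_inv hp] at h1
  exact h h1

/-- Curve selection is applied to the scalar function |V|², which has the zeros of V and finite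
order along the vertical axis. Points where V ≠ 0 are not singular at all. -/
theorem AnalyticChart.eventually_right_notMem (hc : AnalyticChart Φ e V)
    (h0 : (0 : ℝ × ℝ) ∈ e.target) (hV : ¬ ∀ᶠ y in 𝓝 (0 : ℝ), V (0, y) = 0) :
    ∀ᶠ p : ℝ × ℝ in 𝓝 0, 0 < p.1 → e.symm p ∉ essentialSingularSet Φ := by
  have hVA := hc.analytic 0 h0
  have hF : AnalyticAt ℝ (fun p => (V p).1 ^ 2 + (V p).2 ^ 2) 0 :=
    ((AnalyticAt.fun_comp (f := V) analyticAt_fst hVA).pow 2).add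
      ((AnalyticAt.fun_comp (f := V) analyticAt_snd hVA).pow 2)
  have hzero : ∀ p, (V p).1 ^ 2 + (V p).2 ^ 2 = 0 → V p = 0 := fun p h => by
    have h1 : (V p).1 = 0 := by nlinarith [sq_nonneg (V p).1, sq_nonneg (V p).2]
    have h2 : (V p).2 = 0 := by nlinarith [sq_nonneg (V p).1, sq_nonneg (V p).2]
    exact Prod.ext h1 h2
  have hne : analyticOrderAt (fun y => (V (0, y)).1 ^ 2 + (V (0, y)).2 ^ 2) 0 ≠ ⊤ := fun h =>
    hV ((analyticOrderAt_eq_top.1 h).mono fun y hy => hzero _ hy)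
  obtain ⟨n, hn⟩ := ENat.ne_top_iff_exists.1 hne
  have key := arcsSelectZeros n (fun p => (V p).1 ^ 2 + (V p).2 ^ 2)
    {p | e.symm p ∉ essentialSingularSet Φ} hF hn.symm
    fun m φ hm hφ hφ0 => hc.eventually_arc_notMem h0 hV hm hφ hφ0
  filter_upwards [key, e.open_target.mem_nhds h0] with p h1 h2 hpos
  by_cases h3 : V p = 0
  · exact h1 hpos (by simp [h3])
  · exact hc.notMem_of_ne_zero h2 h3

/-- The left half-plane is handled by the reflection x ↦ -x. The axis itself carries no zero of V
near the origin except possibly the origin. -/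
theorem AnalyticChart.eventually_notMem_of_axis (hc : AnalyticChart Φ e V)
    (h0 : (0 : ℝ × ℝ) ∈ e.target) (hV : ¬ ∀ᶠ y in 𝓝 (0 : ℝ), V (0, y) = 0) :
    ∀ᶠ p : ℝ × ℝ in 𝓝[≠] 0, e.symm p ∉ essentialSingularSet Φ := by
  set L : (ℝ × ℝ) ≃L[ℝ] (ℝ × ℝ) :=
    (ContinuousLinearEquiv.neg ℝ).prodCongr (ContinuousLinearEquiv.refl ℝ ℝ) with hL
  have hLs : ∀ p : ℝ × ℝ, L.symm p = (-p.1, p.2) := fun p => by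
    rw [L.symm_apply_eq]
    simp [hL]
  have h0' : (0 : ℝ × ℝ) ∈ (e.transHomeomorph L.toHomeomorph).target := by
    change L.symm 0 ∈ e.target
    rwa [map_zero]
  have hleft := (hc.transLinear L).eventually_right_notMem h0' fun h => hV <| h.mono fun y hy => by
    rw [hLs] at hy
    simpa using hy
  have htend : Tendsto (fun p : ℝ × ℝ => (-p.1, p.2)) (𝓝 0) (𝓝 0) := by
    have := (by fun_prop : Continuous fun p : ℝ × ℝ => (-p.1, p.2)).tendsto 0
    rwa [show (-(0 : ℝ × ℝ).1, (0 : ℝ × ℝ).2) = 0 by simp] at this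
  have haxis : ∀ᶠ y in 𝓝 (0 : ℝ), y ≠ 0 → V (0, y) ≠ 0 := by
    have hA : AnalyticAt ℝ (fun y => V (0, y)) 0 :=
      AnalyticAt.fun_comp (x := (0 : ℝ)) (f := fun y : ℝ => ((0 : ℝ), y)) (hc.analytic 0 h0)
        (analyticAt_const.prod analyticAt_id)
    exact eventually_nhdsWithin_iff.1 (hA.eventually_eq_zero_or_eventually_ne_zero.resolve_left hV)
  rw [eventually_nhdsWithin_iff]
  filter_upwards [hc.eventually_right_notMem h0 hV, htend.eventually hleft,
    (continuousAt_snd (p := (0 : ℝ × ℝ))).eventually haxis, e.open_target.mem_nhds h0]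
    with p h1 h2 h3 h4 hp
  rcases lt_trichotomy p.1 0 with h | h | h
  · have h5 := h2 (neg_pos.2 h)
    have h6 : (e.transHomeomorph L.toHomeomorph).symm (-p.1, p.2) = e.symm p := by
      change e.symm (L.symm (-p.1, p.2)) = _
      rw [hLs, neg_neg]
    rwa [h6] at h5
  · refine hc.notMem_of_ne_zero h4 ?_
    have h5 : p = (0, p.2) := Prod.ext h rfl
    rw [h5]
    exact h3 fun h6 => hp (Prod.ext h h6)
  · exact h1 h

/-- Essential singular points are isolated near a point of a chart in which the flow is generated
by an analytic vector field that does not vanish identically. -/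
theorem AnalyticChart.eventually_notMem (hc : AnalyticChart Φ e V) {p₀ : X} (hp₀ : p₀ ∈ e.source)
    (hp : e p₀ = 0) (hV : ¬ ∀ᶠ w in 𝓝 (0 : ℝ × ℝ), V w = 0) :
    ∀ᶠ q in 𝓝[≠] p₀, q ∉ essentialSingularSet Φ := by
  have h0 : (0 : ℝ × ℝ) ∈ e.target := hp ▸ e.map_source hp₀
  obtain ⟨r, hr, hball⟩ := Metric.isOpen_iff.1 e.open_target 0 h0
  obtain ⟨w, hw, hwb, hwV⟩ : ∃ w ≠ 0, w ∈ Metric.ball (0 : ℝ × ℝ) r ∧ V w ≠ 0 := by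
    by_contra! hcon
    refine hV ?_
    have h1 : ∀ᶠ w in 𝓝[≠] (0 : ℝ × ℝ), V w = 0 := by
      filter_upwards [self_mem_nhdsWithin, mem_nhdsWithin_of_mem_nhds (Metric.ball_mem_nhds 0 hr)]
        with w h1 h2 using hcon w h1 h2
    have h2 : V 0 = 0 := by
      have h3 : Tendsto V (𝓝[≠] 0) (𝓝 (V 0)) :=
        (hc.analytic 0 h0).continuousAt.tendsto.mono_left nhdsWithin_le_nhds
      exact tendsto_nhds_unique (h3.congr' h1) tendsto_const_nhds
    filter_upwards [eventually_nhdsWithin_iff.1 h1] with w h3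
    rcases eq_or_ne w 0 with rfl | h4
    · exact h2
    · exact h3 h4
  -- By the identity theorem along the line through 0 and w: vanishing near 0 would propagate inside
  -- the ball to w, where V ≠ 0.
  have hseg : ¬ ∀ᶠ y in 𝓝 (0 : ℝ), V (y • w) = 0 := by
    intro h
    set U : Set ℝ := (fun y : ℝ => y • w) ⁻¹' Metric.ball 0 r with hU
    have hUc : Convex ℝ U :=
      (convex_ball (0 : ℝ × ℝ) r).linear_preimage (LinearMap.toSpanSingleton ℝ (ℝ × ℝ) w)
    have hA : AnalyticOnNhd ℝ (fun y : ℝ => V (y • w)) U := fun y hy =>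
      AnalyticAt.fun_comp (f := fun y : ℝ => y • w) (hc.analytic _ (hball hy))
        (analyticAt_id.smul analyticAt_const)
    have h1 := hA.eqOn_zero_of_preconnected_of_eventuallyEq_zero hUc.isPreconnected
      (z₀ := 0) (by simp [hU, hr]) h
    have h2 : (1 : ℝ) ∈ U := by simpa only [hU, mem_preimage, one_smul] using hwb
    have h3 := h1 h2
    simp only [one_smul] at h3
    exact hwV h3
  set L := straightenVector w hw
  have key := (hc.transLinear L).eventually_notMem_of_axis
    (by change L.symm 0 ∈ e.target; rwa [map_zero]) fun h => hseg <| h.mono fun y hy => by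
      rw [straightenVector_symm_snd] at hy
      simpa using hy
  have hcont : ContinuousAt (fun q => L (e q)) p₀ :=
    L.continuous.continuousAt.comp (e.continuousAt hp₀)
  have htend : Tendsto (fun q => L (e q)) (𝓝[≠] p₀) (𝓝[≠] 0) := by
    refine tendsto_nhdsWithin_iff.2 ⟨?_, ?_⟩
    · have h1 := hcont.tendsto
      rw [hp, map_zero] at h1
      exact h1.mono_left nhdsWithin_le_nhds
    · filter_upwards [self_mem_nhdsWithin, mem_nhdsWithin_of_mem_nhds (e.open_source.mem_nhds hp₀)]
        with q h1 h2 h3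
      refine h1 (e.injOn h2 hp₀ ?_)
      rw [hp]
      simpa using h3
  filter_upwards [htend.eventually key, mem_nhdsWithin_of_mem_nhds (e.open_source.mem_nhds hp₀)]
    with q h1 h2
  have h3 : (e.transHomeomorph L.toHomeomorph).symm (L (e q)) = q := by
    change e.symm (L.symm (L (e q))) = q
    rw [L.symm_apply_apply, e.left_inv h2]
  rwa [h3] at h1

end LocalDiscreteness

end SurfaceFlow

namespace SurfaceFlow

/-! ### From the surface to planar analytic charts. -/

section Surface

open Set Filter

variable {M : Type*} [TopologicalSpace M] [ChartedSpace (EuclideanSpace ℝ (Fin 2)) M]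
  [IsManifold (𝓡 2) ω M]

/-- The vector field `f` read in the chart at `x₀`. -/
noncomputable def chartField (f : (x : M) → TangentSpace (𝓡 2) x) (x₀ : M)
    (y : EuclideanSpace ℝ (Fin 2)) : EuclideanSpace ℝ (Fin 2) :=
  tangentCoordChange (𝓡 2) ((extChartAt (𝓡 2) x₀).symm y) x₀ ((extChartAt (𝓡 2) x₀).symm y)
    (f ((extChartAt (𝓡 2) x₀).symm y))

theorem analyticAt_chartField {f : (x : M) → TangentSpace (𝓡 2) x} (hf : IsAnalyticVectorField f)
    (x₀ : M) : AnalyticAt ℝ (chartField f x₀) (extChartAt (𝓡 2) x₀ x₀) := by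
  have h1 := (contMDiffAt_iff.1 (hf x₀)).2
  have h2 := (h1.contDiffAt (by simp)).snd.analyticAt
  exact h2

theorem hasDerivAt_chart {f : (x : M) → TangentSpace (𝓡 2) x} {Φ : Flow ℝ M} (hΦ : IsFlowOf Φ f)
    {x₀ q : M} (hq : q ∈ (extChartAt (𝓡 2) x₀).source) :
    HasDerivAt (fun t => extChartAt (𝓡 2) x₀ (Φ t q))
      (chartField f x₀ (extChartAt (𝓡 2) x₀ q)) 0 := by
  have : IsManifold (𝓡 2) 1 M := IsManifold.of_le (n := ω) le_top
  have h0 : Φ 0 q = q := Φ.map_zero_apply q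
  have h1 := (hΦ q).isMIntegralCurveAt 0
  have h2 := h1.eventually_hasDerivAt.self_of_nhds
  have hself : ∀ z, z = q → tangentCoordChange (𝓡 2) z z z (f z) = f q := by
    rintro z rfl
    exact tangentCoordChange_self (mem_extChartAt_source z)
  replace h2 := h2.congr_deriv (hself _ h0)
  simp only [h0] at h2
  have hd := hasFDerivWithinAt_tangentCoordChange (I := 𝓡 2) (x := q) (y := x₀) (z := q)
    ⟨mem_extChartAt_source q, hq⟩
  rw [ModelWithCorners.range_eq_univ, hasFDerivWithinAt_univ] at hd
  have h3 := HasFDerivAt.comp_hasDerivAt_of_eq (0 : ℝ) hd h2 (by simp [h0])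
  have h4 : chartField f x₀ (extChartAt (𝓡 2) x₀ q) = tangentCoordChange (𝓡 2) q x₀ q (f q) := by
    rw [chartField, (extChartAt (𝓡 2) x₀).left_inv hq]
  rw [h4]
  refine h3.congr_of_eventuallyEq ?_
  have hcont : ContinuousAt (fun t => Φ t q) 0 := h1.continuousAt
  have h5 : ∀ᶠ t in 𝓝 (0 : ℝ), Φ t q ∈ (extChartAt (𝓡 2) q).source :=
    hcont.eventually (by simp only [h0]; exact extChartAt_source_mem_nhds q)
  refine h5.mono fun t ht => ?_
  simp only [Function.comp_apply]
  rw [(extChartAt (𝓡 2) q).left_inv ht]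

theorem eq_zero_of_chartField_eq_zero {f : (x : M) → TangentSpace (𝓡 2) x} {x₀ q : M}
    (hq : q ∈ (extChartAt (𝓡 2) x₀).source)
    (h : chartField f x₀ (extChartAt (𝓡 2) x₀ q) = 0) : f q = 0 := by
  have : IsManifold (𝓡 2) 1 M := IsManifold.of_le (n := ω) le_top
  rw [chartField, (extChartAt (𝓡 2) x₀).left_inv hq] at h
  have hqq := mem_extChartAt_source (I := 𝓡 2) q
  have h1 := tangentCoordChange_comp (I := 𝓡 2) (w := q) (x := x₀) (y := q) (z := q) (v := f q)
    ⟨⟨hqq, hq⟩, hqq⟩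
  rw [h, map_zero] at h1
  exact (h1.trans (tangentCoordChange_self hqq)).symm

/-- Uniqueness of integral curves: the constant curve at a zero of f is one of them. -/
theorem isSingular_of_eq_zero [T2Space M] {f : (x : M) → TangentSpace (𝓡 2) x} {Φ : Flow ℝ M}
    (hf : IsAnalyticVectorField f) (hΦ : IsFlowOf Φ f) {q : M} (h : f q = 0) :
    IsSingular Φ q := by
  have : IsManifold (𝓡 2) 1 M := IsManifold.of_le (n := ω) le_top
  have h1 := isMIntegralCurve_Ioo_eq_of_contMDiff_boundaryless (t₀ := 0) (hf.of_le le_top) (hΦ q)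
    (isMIntegralCurve_const h) (Φ.map_zero_apply q)
  exact fun t => congrFun h1 t

theorem eq_zero_of_isSingular {f : (x : M) → TangentSpace (𝓡 2) x} {Φ : Flow ℝ M}
    (hΦ : IsFlowOf Φ f) {q : M} (h : IsSingular Φ q) : f q = 0 := by
  have hq := mem_extChartAt_source (I := 𝓡 2) q
  refine eq_zero_of_chartField_eq_zero hq ?_
  refine (hasDerivAt_chart hΦ hq).unique ?_
  have h1 : (fun t => extChartAt (𝓡 2) q (Φ t q)) = fun _ => extChartAt (𝓡 2) q q :=
    funext fun t => by rw [h t]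
  rw [h1]
  exact hasDerivAt_const _ _

/-- The flow of an analytic vector field is analytic in suitable charts whose range is a disk. -/
theorem exists_analyticChart [T2Space M] {f : (x : M) → TangentSpace (𝓡 2) x} {Φ : Flow ℝ M}
    (hf : IsAnalyticVectorField f) (hΦ : IsFlowOf Φ f) (x₀ : M) :
    ∃ (e : OpenPartialHomeomorph M (ℝ × ℝ)) (V : ℝ × ℝ → ℝ × ℝ), AnalyticChart Φ e V ∧
      x₀ ∈ e.source ∧ e x₀ = 0 ∧ Convex ℝ e.target := by
  obtain ⟨L⟩ : Nonempty (EuclideanSpace ℝ (Fin 2) ≃L[ℝ] (ℝ × ℝ)) :=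
    ⟨ContinuousLinearEquiv.ofFinrankEq (by simp)⟩
  set b : ℝ × ℝ := L (extChartAt (𝓡 2) x₀ x₀) with hb
  set V : ℝ × ℝ → ℝ × ℝ := fun p => L (chartField f x₀ (L.symm (p + b))) with hV
  set e₁ : OpenPartialHomeomorph M (ℝ × ℝ) :=
    (chartAt (EuclideanSpace ℝ (Fin 2)) x₀).transHomeomorph
      (L.toHomeomorph.trans (Homeomorph.subRight b)) with he₁
  have hx₀ : x₀ ∈ e₁.source := mem_chart_source _ x₀
  have he : ∀ q, e₁ q = L (extChartAt (𝓡 2) x₀ q) - b := fun q => by simp [he₁]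
  have he0 : e₁ x₀ = 0 := by rw [he, hb, sub_self]
  have hVA : AnalyticAt ℝ V 0 := by
    refine AnalyticAt.fun_comp (L.analyticAt _) ?_
    refine AnalyticAt.fun_comp (x := (0 : ℝ × ℝ)) (f := fun p => L.symm (p + b)) ?_
      (AnalyticAt.fun_comp (L.symm.analyticAt _) (analyticAt_id.add analyticAt_const))
    rw [zero_add, hb, L.symm_apply_apply]
    exact analyticAt_chartField hf x₀
  -- Analyticity of V is known at the centre, hence nearby. Cutting the chart down to a ball makes V
  -- analytic on the whole target and the target convex, as the identity theorem requires.
  obtain ⟨r, hr, hball⟩ := Metric.eventually_nhds_iff_ball.1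
    (hVA.eventually_analyticAt.and (e₁.open_target.mem_nhds (he0 ▸ e₁.map_source hx₀)))
  refine ⟨(e₁.symm.restrOpen (Metric.ball 0 r) Metric.isOpen_ball).symm, V, ⟨?_, ?_, ?_⟩, ?_, he0,
    ?_⟩
  · intro p hp
    exact (hball p hp.2).1
  · intro q hq
    have hq' : q ∈ (extChartAt (𝓡 2) x₀).source := by
      rw [extChartAt_source]
      exact hq.1
    have h1 := (L.hasFDerivAt.comp_hasDerivAt (x := (0 : ℝ)) (hasDerivAt_chart hΦ hq')).sub_const b
    have h2 : V (e₁ q) = L (chartField f x₀ (extChartAt (𝓡 2) x₀ q)) := by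
      rw [hV, he]; simp only [sub_add_cancel, L.symm_apply_apply]
    change HasDerivAt (fun t => e₁ (Φ t q)) (V (e₁ q)) 0
    rw [h2]
    simp only [he]
    exact h1
  · intro q hq h
    have hq' : q ∈ (extChartAt (𝓡 2) x₀).source := by
      rw [extChartAt_source]
      exact hq.1
    change V (e₁ q) = 0 at h
    refine isSingular_of_eq_zero hf hΦ (eq_zero_of_chartField_eq_zero hq' ?_)
    rw [hV, he] at h
    simpa using h
  · exact ⟨hx₀, by change e₁ x₀ ∈ Metric.ball 0 r; rw [he0]; exact Metric.mem_ball_self hr⟩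
  · have h1 : (e₁.symm.restrOpen (Metric.ball 0 r) Metric.isOpen_ball).symm.target =
        Metric.ball 0 r := by
      change e₁.target ∩ Metric.ball 0 r = _
      exact inter_eq_right.2 fun p hp => (hball p hp).2
    rw [h1]
    exact convex_ball _ _

/-- A point in the closure of the interior of the singular set lies in that interior. -/
theorem AnalyticChart.eventually_isSingular {X : Type*} [TopologicalSpace X] {Φ : Flow ℝ X}
    {e : OpenPartialHomeomorph X (ℝ × ℝ)} {V : ℝ × ℝ → ℝ × ℝ} (hc : AnalyticChart Φ e V)
    (hconv : Convex ℝ e.target) {x : X} (hx : x ∈ e.source)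
    (hcl : x ∈ closure (interior {q | IsSingular Φ q})) : ∀ᶠ q in 𝓝 x, IsSingular Φ q := by
  obtain ⟨q, hqe, hqi⟩ := mem_closure_iff.1 hcl e.source e.open_source hx
  have h1 : ∀ᶠ w in 𝓝 (e q), V w = 0 := by
    have h2 : ∀ᶠ w in 𝓝 (e q), e.symm w ∈ interior {q | IsSingular Φ q} :=
      (e.continuousAt_symm (e.map_source hqe)).eventually
        (by rw [e.left_inv hqe]; exact isOpen_interior.mem_nhds hqi)
    filter_upwards [h2, e.open_target.mem_nhds (e.map_source hqe)] with w h3 h4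
    have h5 := (hc.isSingular_iff (e.map_target h4)).1 (interior_subset h3)
    rwa [e.right_inv h4] at h5
  have h2 := hc.analytic.eqOn_zero_of_preconnected_of_eventuallyEq_zero hconv.isPreconnected
    (e.map_source hqe) h1
  filter_upwards [e.open_source.mem_nhds hx] with y hy
  exact hc.sing y hy (h2 (e.map_source hy))

end Surface

end SurfaceFlow

theorem proposition2 {M : Type*} [TopologicalSpace M] [T2Space M] [SecondCountableTopology M]
    [ConnectedSpace M] [ChartedSpace (EuclideanSpace ℝ (Fin 2)) M] [IsManifold (𝓡 2) ω M]
    (Φ : Flow ℝ M) (f : (x : M) → TangentSpace (𝓡 2) x)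
    (hf : SurfaceFlow.IsAnalyticVectorField f) (hΦ : SurfaceFlow.IsFlowOf Φ f) :
    (∀ x : M, f x = 0) ∨ IsDiscrete (SurfaceFlow.essentialSingularSet Φ) := by
  -- Z is open by definition and closed by the identity theorem in charts with convex target;
  -- connectedness leaves only the empty set and M.
  set Z : Set M := interior {q | SurfaceFlow.IsSingular Φ q} with hZ
  have hclosed : IsClosed Z := by
    refine isClosed_of_closure_subset fun x hx => ?_
    obtain ⟨e, V, hc, hxe, -, hconv⟩ := SurfaceFlow.exists_analyticChart hf hΦ x
    exact mem_interior_iff_mem_nhds.2 (hc.eventually_isSingular hconv hxe hx)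
  rcases isClopen_iff.1 ⟨hclosed, isOpen_interior⟩ with hempty | huniv
  · right
    rw [isDiscrete_iff_nhdsNE]
    intro x _
    obtain ⟨e, V, hc, hxe, hx0, -⟩ := SurfaceFlow.exists_analyticChart hf hΦ x
    -- If V vanished near 0, then x would be an interior point of the singular set, which is
    -- excluded in this case.
    have hV : ¬ ∀ᶠ w in 𝓝 (0 : ℝ × ℝ), V w = 0 := by
      intro h
      have h1 : x ∈ Z := by
        refine mem_interior_iff_mem_nhds.2 ?_
        have h2 : ∀ᶠ q in 𝓝 x, V (e q) = 0 :=
          (e.continuousAt hxe).eventually (by rw [hx0]; exact h)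
        filter_upwards [h2, e.open_source.mem_nhds hxe] with q h3 h4
        exact hc.sing q h4 h3
      rw [hempty] at h1
      exact h1
    have h1 := hc.eventually_notMem hxe hx0 hV
    rw [← disjoint_iff, Filter.disjoint_principal_right]
    exact h1
  · left
    intro x
    have h1 : x ∈ Z := by rw [huniv]; trivial
    exact SurfaceFlow.eq_zero_of_isSingular hΦ (interior_subset h1)
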